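/- Let $R(X)=\sum_{k=0}^{s}\alpha_kX^k$ be a real polynomial with $\alpha_0=\alpha_1=1$, and consider the explicit Runge--Kutta method $u_+=R(Z)u_0$, $Z=\tau L$, for linear systems $u'=Lu$ in real inner product spaces $V$, where $L$ is a bounded operator on $V$ with an adjoint $L^\top$ on $V$ and is semi-negative: $\langle Lv,v\rangle\le 0$ for all $v\in V$. Let the method be of linear order $p$, i.e. $\alpha_k=1/k!$ for $k\le p$ and $\alpha_{p+1}\ne 1/(p+1)!$ (with $\alpha_k=0$ for $k>s$). Put $[\![v,w]\!]=-\langle Zv,w\rangle-\langle v,Zw\rangle$, and let $\beta_k$ $(1\le k\le s)$ and $\gamma_{i,j}=\gamma_{j,i}$ $(0\le i,j\le s-1)$ be the real coefficients, determined by $R$, for which $$\|R(Z)u_0\|^2-\|u_0\|^2=\sum_{k=1}^{s}\beta_k\|Z^ku_0\|^2+\sum_{i,j=0}^{s-1}\gamma_{i,j}[\![Z^iu_0,Z^ju_0]\!]$$ holds identically in $V$, $Z$ and $u_0$. Explicitly, $\beta_k=\alpha_k^2+2\sum_{l=1}^{k}(-1)^l\alpha_{k+l}\alpha_{k-l}$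 and $\gamma_{i,j}=\sum_{l=0}^{j}(-1)^{l+1}\alpha_{i+1+l}\alpha_{j-l}$ for $i\ge j$. The leading index $k^*$ is the smallest $k\ge1$ with $\beta_k\ne0$, and $\Gamma^*=(\gamma_{i,j})_{0\le i,j\le k^*-1}$. Assume that $k^*=\lceil\frac{p+1}{2}\rceil$. For $\mu,\nu\in\mathbb R$ let $W=\mu(Z^\top)^{k^*-1}Z^{k^*}+\nu(Z^\top)^{k^*}Z^{k^*}$. The modified method is $u_{\rm M}=R(Z+W)u_0$ and the filtering method is $u_{\rm F}=(I+W)R(Z)u_0$. If $p$ is even, there is a real number $\mu_0$ such that $\Gamma^*-\mathrm{diag}(0,\dots,0,\mu_0)$ is negative semidefinite. Suppose that $\nu<\nu_0=-\beta_{k^*}/2$, and that either 1. $p$ is odd and $\mu=0$, or 2. $p$ is even and $\mu>\mu_0$ for some real $\mu_0$ such that $\Gamma^*-\mathrm{diag}(0,\dots,0,\mu_0)$ is negative semidefinite. Then both the modified method ($\#={\rm M}$) and the filtering method ($\#={\rm F}$) * are strongly stable: there is $\lambda>0$, depending only on $R,\mu,\nu$, such that $\|u_\#\|\le\|u_0\|$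 for every $V$, every $L$ as above, every $\tau>0$ with $\|\tau L\|\le\lambda$, and every $u_0\in V$; * are of linear order $p$: for every $V$ and $L$ as above there are constants $C$ and $\tau_0>0$ such that every solution $u$ of $u'=Lu$ on $[0,\infty)$ satisfies $\|u_\#-u(\tau)\|\le C\tau^{p+1}\|u(0)\|$ for $0<\tau\le\tau_0$, where $u_\#$ is computed from $u_0=u(0)$; and the same property with $p+1$ in place of $p$ fails (for some $V$ and $L$). -/

import Mathlib

open Polynomial
open scoped InnerProductSpace

universe u

noncomputable section

namespace Superviscosity

/-! ### Explicit Runge-Kutta methods on linear problems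

A method is given by its stability polynomial `R = ∑ α_k X^k`, with `α_k = R.coeff k`. -/

/-- Consistency: `α_0 = α_1 = 1`. -/
def IsConsistent (R : ℝ[X]) : Prop :=
  R.coeff 0 = 1 ∧ R.coeff 1 = 1

/-- The method with stability polynomial `R` is of linear order (exactly) `p`. -/
def HasRKOrder (R : ℝ[X]) (p : ℕ) : Prop :=
  (∀ k ≤ p, R.coeff k = 1 / (k.factorial : ℝ)) ∧
    R.coeff (p + 1) ≠ 1 / ((p + 1).factorial : ℝ)

/-! ### The coefficients of the energy identity

`energyBeta` and `energyGamma` are the coefficients of the identity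
`‖R(Z)u‖² - ‖u‖² = ∑_{k=1}^s β_k ‖Z^k u‖² + ∑_{i,j<s} γ_{ij} ⟦Z^i u, Z^j u⟧`, with `γ` symmetric
and `⟦v, w⟧ = -⟪Zv, w⟫ - ⟪v, Zw⟫`; the identity is proved below (`energy_identity`).
They are what repeated use of `⟪Zv, w⟫ = -⟪v, Zw⟫ - ⟦v, w⟧` produces. -/

/-- The coefficient `γ_{ij}` (symmetric in `i`, `j`). -/
def energyGamma (R : ℝ[X]) (i j : ℕ) : ℝ :=
  ∑ l ∈ Finset.range (min i j + 1),
    (-1) ^ (l + 1) * (R.coeff (max i j + 1 + l) * R.coeff (min i j - l))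

/-- The coefficient `β_k`, for `k ≥ 1`. -/
def energyBeta (R : ℝ[X]) (k : ℕ) : ℝ :=
  R.coeff k ^ 2 +
    2 * ∑ l ∈ Finset.range k, (-1) ^ (l + 1) * (R.coeff (k + 1 + l) * R.coeff (k - 1 - l))

/-- The leading index `k*`: the first `k ≥ 1` with `β_k ≠ 0`. -/
def leadingIndex (R : ℝ[X]) : ℕ :=
  sInf {k : ℕ | 1 ≤ k ∧ energyBeta R k ≠ 0}

/-- The leading submatrix `Γ* = (γ_{ij})_{0 ≤ i, j ≤ k* - 1}`. -/
def leadingMatrix (R : ℝ[X]) : Matrix (Fin (leadingIndex R)) (Fin (leadingIndex R)) ℝ :=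
  Matrix.of fun i j => energyGamma R i j

/-- The diagonal matrix `diag(0, …, 0, c)` of size `n`. -/
def lastDiag (n : ℕ) (c : ℝ) : Matrix (Fin n) (Fin n) ℝ :=
  Matrix.diagonal fun i => if (i : ℕ) + 1 = n then c else 0

/-- `Γ* - diag(0, …, 0, μ₀) ≤ 0`, i.e. this symmetric matrix is negative semidefinite. -/
def IsDispersiveBound (R : ℝ[X]) (μ₀ : ℝ) : Prop :=
  (-(leadingMatrix R - lastDiag (leadingIndex R) μ₀)).PosSemidef

/-! ### One-step methods -/

/-- A one-step method for `u' = L u`: in every real inner product space it maps `Z = τ L` and its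
adjoint `Zᵀ` to the operator that takes the current value to the next one. -/
def LinearMethod : Type (u + 1) :=
  ∀ (V : Type u) [NormedAddCommGroup V] [InnerProductSpace ℝ V],
    (V →L[ℝ] V) → (V →L[ℝ] V) → (V →L[ℝ] V)

/-- The superviscosity term `μ (Zᵀ)^{k*-1} Z^{k*} + ν (Zᵀ)^{k*} Z^{k*}`, with `k = k*`. -/
def superviscosity (k : ℕ) (μ ν : ℝ) {V : Type u} [NormedAddCommGroup V] [InnerProductSpace ℝ V]
    (Z Zt : V →L[ℝ] V) : V →L[ℝ] V :=
  μ • (Zt ^ (k - 1) * Z ^ k) + ν • (Zt ^ k * Z ^ k)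

/-- The modified method: `u_M = R(Z̃) u₀`, where
`Z̃ = Z + μ (Zᵀ)^{k*-1} Z^{k*} + ν (Zᵀ)^{k*} Z^{k*}`. -/
def modifiedMethod (R : ℝ[X]) (μ ν : ℝ) : LinearMethod.{u} :=
  fun _ _ _ Z Zt => aeval (Z + superviscosity (leadingIndex R) μ ν Z Zt) R

/-- The filtering method: `u_F = (I + μ (Zᵀ)^{k*-1} Z^{k*} + ν (Zᵀ)^{k*} Z^{k*}) R(Z) u₀`. -/
def filteringMethod (R : ℝ[X]) (μ ν : ℝ) : LinearMethod.{u} :=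
  fun _ _ _ Z Zt => (1 + superviscosity (leadingIndex R) μ ν Z Zt) * aeval Z R

/-- `L` is semi-negative. -/
def IsSemiNegative {V : Type u} [NormedAddCommGroup V] [InnerProductSpace ℝ V]
    (L : V →L[ℝ] V) : Prop :=
  ∀ v, ⟪L v, v⟫_ℝ ≤ 0

/-- `Lt` is the adjoint of `L`. It is unique; if `V` is complete it exists, and it is
`ContinuousLinearMap.adjoint L`. Completeness is not assumed. -/
def IsAdjointOf {V : Type u} [NormedAddCommGroup V] [InnerProductSpace ℝ V]
    (Lt L : V →L[ℝ] V) : Prop :=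
  ∀ v w, ⟪L v, w⟫_ℝ = ⟪v, Lt w⟫_ℝ

/-- `u` solves `u' = L u` on `[0, ∞)`. -/
def IsSolution {V : Type u} [NormedAddCommGroup V] [InnerProductSpace ℝ V]
    (L : V →L[ℝ] V) (x : ℝ → V) : Prop :=
  ∀ t, 0 ≤ t → HasDerivWithinAt x (L (x t)) (Set.Ici 0) t

/-- Strong stability: there is a step size constant `lam > 0`, depending on the method only, such
that the norm does not increase in a step with `‖τ L‖ ≤ lam`, for all semi-negative systems. -/
def IsStronglyStable (Φ : LinearMethod.{u}) : Prop :=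
  ∃ lam : ℝ, 0 < lam ∧
    ∀ (V : Type u) [NormedAddCommGroup V] [InnerProductSpace ℝ V] (L Lt : V →L[ℝ] V),
      IsSemiNegative L → IsAdjointOf Lt L →
        ∀ τ : ℝ, 0 < τ → ‖τ • L‖ ≤ lam → ∀ u₀ : V, ‖Φ V (τ • L) (τ • Lt) u₀‖ ≤ ‖u₀‖

/-- Linear order at least `p`: for every semi-negative system the local truncation error is
`O(τ^{p+1})`, uniformly in the initial value. -/
def HasLinearOrderAtLeast (Φ : LinearMethod.{u}) (p : ℕ) : Prop :=
  ∀ (V : Type u) [NormedAddCommGroup V] [InnerProductSpace ℝ V] (L Lt : V →L[ℝ] V),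
    IsSemiNegative L → IsAdjointOf Lt L →
      ∃ C τ₀ : ℝ, 0 < τ₀ ∧ ∀ x : ℝ → V, IsSolution L x →
        ∀ τ : ℝ, 0 < τ → τ ≤ τ₀ →
          ‖Φ V (τ • L) (τ • Lt) (x 0) - x τ‖ ≤ C * τ ^ (p + 1) * ‖x 0‖

/-- Linear order exactly `p`. For the Runge-Kutta method `Z ↦ R(Z)` itself this amounts to
`HasRKOrder R p`. -/
def HasLinearOrder (Φ : LinearMethod.{u}) (p : ℕ) : Prop :=
  HasLinearOrderAtLeast Φ p ∧ ¬ HasLinearOrderAtLeast Φ (p + 1)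

/-! ### Facts that justify the definitions -/

theorem energyGamma_comm (R : ℝ[X]) (i j : ℕ) : energyGamma R i j = energyGamma R j i := by
  unfold energyGamma
  rw [min_comm, max_comm]

theorem energyGamma_eq_zero (R : ℝ[X]) {s i j : ℕ} (hs : R.natDegree ≤ s) (h : s ≤ max i j) :
    energyGamma R i j = 0 := by
  unfold energyGamma
  refine Finset.sum_eq_zero fun l _ => ?_
  rw [Polynomial.coeff_eq_zero_of_natDegree_lt (by omega)]
  simp

theorem energyBeta_succ (R : ℝ[X]) (m : ℕ) :
    energyBeta R (m + 1) = R.coeff (m + 1) ^ 2 + 2 * energyGamma R (m + 1) m := by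
  unfold energyBeta energyGamma
  simp

theorem energyGamma_step (R : ℝ[X]) {m n : ℕ} (h : n < m) :
    energyGamma R m (n + 1) + energyGamma R (m + 1) n = -(R.coeff (m + 1) * R.coeff (n + 1)) := by
  unfold energyGamma
  rw [min_eq_right (by omega : n + 1 ≤ m), max_eq_left (by omega : n + 1 ≤ m),
    min_eq_right (by omega : n ≤ m + 1), max_eq_left (by omega : n ≤ m + 1),
    Finset.sum_range_succ' _ (n + 1), add_right_comm, ← Finset.sum_add_distrib,
    Finset.sum_eq_zero]
  · simp
  · intro l _
    rw [show m + 1 + (l + 1) = m + 1 + 1 + l by omega, show n + 1 - (l + 1) = n - l by omega]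
    ring

/-- The coefficients of `⟪Z^m u, Z^n u⟫` on both sides of the energy identity agree. -/
theorem energy_coeff (R : ℝ[X]) (m n : ℕ) :
    R.coeff (m + 1) * R.coeff (n + 1) =
      (if m = n then energyBeta R (m + 1) else 0)
        - energyGamma R m (n + 1) - energyGamma R (m + 1) n := by
  rcases lt_trichotomy n m with h | h | h
  · rw [if_neg (by omega)]
    linarith [energyGamma_step R h]
  · subst h
    rw [if_pos rfl, energyBeta_succ, energyGamma_comm R n (n + 1)]
    ring
  · rw [if_neg (by omega), energyGamma_comm R m, energyGamma_comm R (m + 1)]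
    linarith [energyGamma_step R h]

theorem energy_coeff_zero (R : ℝ[X]) (m : ℕ) :
    R.coeff (m + 1) * R.coeff 0 = -energyGamma R m 0 := by
  simp [energyGamma]

/-- The energy identity: it exhibits `energyBeta` and `energyGamma` as the coefficients that they
are meant to be. -/
theorem energy_identity (R : ℝ[X]) (h0 : R.coeff 0 = 1) (s : ℕ) (hs : R.natDegree ≤ s)
    {V : Type u} [NormedAddCommGroup V] [InnerProductSpace ℝ V] (Z : V →L[ℝ] V) (v : V) :
    ‖aeval Z R v‖ ^ 2 - ‖v‖ ^ 2 =
      ∑ k ∈ Finset.Icc 1 s, energyBeta R k * ‖(Z ^ k) v‖ ^ 2 +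
        ∑ i ∈ Finset.range s, ∑ j ∈ Finset.range s, energyGamma R i j *
          (-⟪Z ((Z ^ i) v), (Z ^ j) v⟫_ℝ - ⟪(Z ^ i) v, Z ((Z ^ j) v)⟫_ℝ) := by
  set g : ℕ → ℕ → ℝ := fun i j => ⟪(Z ^ i) v, (Z ^ j) v⟫_ℝ with hg
  have hZ : ∀ i, Z ((Z ^ i) v) = (Z ^ (i + 1)) v := fun i => by
    rw [pow_succ']; rfl
  have hnorm : ∀ k, ‖(Z ^ k) v‖ ^ 2 = g k k := fun k => (real_inner_self_eq_norm_sq _).symm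
  have hL : ‖aeval Z R v‖ ^ 2 =
      ∑ i ∈ Finset.range (s + 1), ∑ j ∈ Finset.range (s + 1),
        R.coeff i * R.coeff j * g i j := by
    rw [← real_inner_self_eq_norm_sq, Polynomial.aeval_eq_sum_range' (Nat.lt_succ_of_le hs)]
    simp only [_root_.sum_apply, _root_.smul_apply, sum_inner,
      inner_sum, real_inner_smul_left, real_inner_smul_right, hg]
    rw [Finset.sum_comm]
    refine Finset.sum_congr rfl fun i _ => Finset.sum_congr rfl fun j _ => ?_
    rw [real_inner_comm]
    ring
  have hv : ‖v‖ ^ 2 = g 0 0 := by simpa using hnorm 0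
  have hB : ∑ k ∈ Finset.Icc 1 s, energyBeta R k * ‖(Z ^ k) v‖ ^ 2 =
      ∑ m ∈ Finset.range s, ∑ n ∈ Finset.range s,
        (if m = n then energyBeta R (m + 1) else 0) * g (m + 1) (n + 1) := by
    rw [Finset.range_eq_Ico, Finset.sum_congr rfl fun k _ => by rw [hnorm k],
      show Finset.Icc 1 s = Finset.Ico (0 + 1) (s + 1) by ext; simp,
      ← Finset.sum_Ico_add' (fun k => energyBeta R k * g k k)]
    refine Finset.sum_congr rfl fun m hm => ?_
    simp only [ite_mul, zero_mul, Finset.sum_ite_eq, if_pos hm]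
  have hG1 : ∑ i ∈ Finset.range s, ∑ j ∈ Finset.range s, energyGamma R i j * g (i + 1) j =
      ∑ i ∈ Finset.range s, (∑ j ∈ Finset.range s, energyGamma R i (j + 1) * g (i + 1) (j + 1)
        + energyGamma R i 0 * g (i + 1) 0) := by
    refine Finset.sum_congr rfl fun i _ => ?_
    rw [← Finset.sum_range_succ' (fun j => energyGamma R i j * g (i + 1) j),
      Finset.sum_range_succ, energyGamma_eq_zero R hs (le_max_right i s)]
    simp
  have hG2 : ∑ i ∈ Finset.range s, ∑ j ∈ Finset.range s, energyGamma R i j * g i (j + 1) =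
      ∑ i ∈ Finset.range s, ∑ j ∈ Finset.range s, energyGamma R (i + 1) j * g (i + 1) (j + 1)
        + ∑ j ∈ Finset.range s, energyGamma R 0 j * g 0 (j + 1) := by
    rw [← Finset.sum_range_succ'
      (fun i => ∑ j ∈ Finset.range s, energyGamma R i j * g i (j + 1)), Finset.sum_range_succ,
      left_eq_add]
    refine Finset.sum_eq_zero fun j _ => ?_
    rw [energyGamma_eq_zero R hs (le_max_left s j), zero_mul]
  have hR : ∑ i ∈ Finset.range s, ∑ j ∈ Finset.range s, energyGamma R i j *
          (-⟪Z ((Z ^ i) v), (Z ^ j) v⟫_ℝ - ⟪(Z ^ i) v, Z ((Z ^ j) v)⟫_ℝ) =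
      -(∑ i ∈ Finset.range s, ∑ j ∈ Finset.range s, energyGamma R i j * g (i + 1) j)
        - ∑ i ∈ Finset.range s, ∑ j ∈ Finset.range s, energyGamma R i j * g i (j + 1) := by
    simp only [← Finset.sum_neg_distrib, ← Finset.sum_sub_distrib, hZ, hg]
    refine Finset.sum_congr rfl fun i _ => Finset.sum_congr rfl fun j _ => ?_
    ring
  rw [hR, hB, hG1, hG2, hL, hv, Finset.sum_range_succ', Finset.sum_range_succ']
  simp only [Finset.sum_range_succ' _ s, Finset.sum_add_distrib, energy_coeff, h0]
  have e1 : ∀ i, R.coeff (i + 1) * 1 = -energyGamma R i 0 := fun i => by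
    rw [← energy_coeff_zero, h0]
  have e2 : ∀ i, 1 * R.coeff (i + 1) = -energyGamma R 0 i := fun i => by
    rw [energyGamma_comm, ← e1]; ring
  simp only [e1, e2, sub_mul, neg_mul, Finset.sum_sub_distrib, Finset.sum_neg_distrib]
  ring

/-- For a consistent method the leading index exists. -/
theorem leadingIndex_spec (R : ℝ[X]) (h1 : R.coeff 1 = 1) :
    1 ≤ leadingIndex R ∧ energyBeta R (leadingIndex R) ≠ 0 := by
  refine Nat.sInf_mem (s := {k : ℕ | 1 ≤ k ∧ energyBeta R k ≠ 0}) ⟨R.natDegree, ?_, ?_⟩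
  · exact Polynomial.le_natDegree_of_ne_zero (by rw [h1]; exact one_ne_zero)
  · have hne : R ≠ 0 := by rintro rfl; simp at h1
    unfold energyBeta
    rw [Finset.sum_eq_zero fun l _ => by
      rw [Polynomial.coeff_eq_zero_of_natDegree_lt (by omega)]; simp]
    simpa using hne

end Superviscosity

end

open Superviscosity

namespace Superviscosity

/-! ### Positive definite matrices and semidefinite bilinear forms -/

/-! Write `k` for the leading index, `⟦·,·⟧` for the dissipation form of `Z`, and `q² = ∑_{i<k} ⟦Z^i
v, Z^i v⟧ + ‖Z^k v‖²`. In the energy identity the `β_j` with `j < k` vanish, and every term with an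
index beyond the leading block is `O(s q²)`, where `s` is of the size of `√‖Z‖`. Up to that error
only `β_k ‖Z^k v‖²` and the form with matrix `Γ*` remain.

For the exponential, `‖e^Z v‖² - ‖v‖² = -∫₀¹ ⟦e^{tZ} v, e^{tZ} v⟧ dt`. Hence `γ_{ij} = -1/((i+j+1)
i! j!)` as long as `i + j + 1 ≤ p`, and this is minus the Gram matrix of the functions `t^i/i!` in
`L²(0,1)` (`expMatrix_posDef`). For odd `p` this covers all of `Γ*`; for even `p` only the corner
entry `i = j = k - 1` escapes. To leading order both methods add `2⟪Wv, v⟫ = -μ ⟦Z^{k-1} v, Z^{k-1}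
v⟧ + 2ν ‖Z^k v‖²`, so `μ` repairs the corner and `ν` makes `β_k + 2ν` negative. The leading part is
then at most `-c q²` (`exists_leading_part_le`), with `c` independent of the space, and it absorbs
the errors `O(s q²)` (`isStronglyStable_of_energy_le`).

For the order, `W` is `O(τ^{p+1})` and enters the error linearly, so the coefficient of `τ^{p+1}` is
`c L^{p+1} + D` with `c ≠ 0` and `D` the leading coefficient of `W`. On multiplication by a complex
unit `z`, the power `L^{p+1}` is `z^{p+1}`, whereas the conjugate factors in `D` cancel powers of
`z`. The two have different phases and cannot cancel for every `z`
(`HasTruncationError.not_hasLinearOrderAtLeast`). -/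

theorem sum_mul_bilin_eq {ι κ V : Type*} [Fintype ι] [Fintype κ] [AddCommGroup V] [Module ℝ V]
    (B : LinearMap.BilinForm ℝ V) (U : Matrix ι κ ℝ) (d : κ → ℝ) (y : ι → V) :
    ∑ i, ∑ j, (∑ l, U i l * d l * U j l) * B (y i) (y j) =
      ∑ l, d l * B (∑ i, U i l • y i) (∑ j, U j l • y j) := by
  simp only [map_sum, LinearMap.sum_apply, map_smul, LinearMap.smul_apply, smul_eq_mul,
    Finset.mul_sum, Finset.sum_mul]
  calc ∑ i, ∑ j, ∑ l, U i l * d l * U j l * B (y i) (y j)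
      = ∑ i, ∑ l, ∑ j, U i l * d l * U j l * B (y i) (y j) :=
        Finset.sum_congr rfl fun i _ => Finset.sum_comm
    _ = ∑ l, ∑ i, ∑ j, U i l * d l * U j l * B (y i) (y j) := Finset.sum_comm
    _ = ∑ l, ∑ j, ∑ i, U i l * d l * U j l * B (y i) (y j) :=
        Finset.sum_congr rfl fun i _ => Finset.sum_comm
    _ = _ := by
        refine Finset.sum_congr rfl fun l _ => Finset.sum_congr rfl fun j _ =>
          Finset.sum_congr rfl fun i _ => ?_
        ring

/-- A positive definite matrix is bounded below by a multiple of the identity, also when it is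
applied to the Gram matrix of a semidefinite bilinear form. -/
theorem exists_pos_le_sum_mul_bilin {ι : Type*} [Fintype ι] [DecidableEq ι] {A : Matrix ι ι ℝ}
    (hA : A.PosDef) :
    ∃ c : ℝ, 0 < c ∧ ∀ (V : Type u) [AddCommGroup V] [Module ℝ V] (B : LinearMap.BilinForm ℝ V),
      (∀ x, 0 ≤ B x x) → ∀ y : ι → V,
        c * ∑ i, B (y i) (y i) ≤ ∑ i, ∑ j, A i j * B (y i) (y j) := by
  obtain ⟨c, hc, hle⟩ : ∃ c : ℝ, 0 < c ∧ ∀ i, c ≤ hA.isHermitian.eigenvalues i := by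
    rcases isEmpty_or_nonempty ι with h | h
    · exact ⟨1, one_pos, fun i => h.elim i⟩
    · obtain ⟨i, hi⟩ := Finite.exists_min hA.isHermitian.eigenvalues
      exact ⟨_, hA.eigenvalues_pos i, hi⟩
  refine ⟨c, hc, fun V _ _ B hB y => ?_⟩
  set U : Matrix ι ι ℝ := hA.isHermitian.eigenvectorUnitary.1 with hU
  have hUU : U * star U = 1 := Unitary.coe_mul_star_self _
  -- `sum_mul_bilin_eq` is used twice: weights `1` give the identity matrix, since `U` is
  -- orthogonal, and the eigenvalues as weights give `A`. Both sums become diagonal in the same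
  -- rotated vectors and compare term by term.
  have h1 : ∀ i j, ∑ l, U i l * (1 : ι → ℝ) l * U j l = if i = j then 1 else 0 := fun i j => by
    have := congrFun (congrFun hUU i) j
    rw [Matrix.mul_apply, Matrix.one_apply] at this
    simpa using this
  have h2 : ∀ i j, ∑ l, U i l * hA.isHermitian.eigenvalues l * U j l = A i j := fun i j => by
    conv_rhs => rw [hA.isHermitian.spectral_theorem]
    rw [Unitary.conjStarAlgAut_apply, Matrix.mul_apply]
    refine Finset.sum_congr rfl fun l _ => ?_
    rw [Matrix.mul_diagonal]
    simp [hU]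
  have e1 : ∑ i, B (y i) (y i) = ∑ l, B (∑ i, U i l • y i) (∑ j, U j l • y j) := by
    have := sum_mul_bilin_eq B U 1 y
    simp only [h1] at this
    simpa using this
  have e2 := sum_mul_bilin_eq B U hA.isHermitian.eigenvalues y
  simp only [h2] at e2
  rw [e1, e2, Finset.mul_sum]
  exact Finset.sum_le_sum fun l _ => mul_le_mul_of_nonneg_right (hle l) (hB _)

/-! ### The Hilbert-type matrix of the exponential function -/

/-- The matrix `1 / ((i + j + 1) i! j!)`. -/
noncomputable def expMatrix (k : ℕ) : Matrix (Fin k) (Fin k) ℝ :=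
  Matrix.of fun i j => 1 / (((i : ℝ) + j + 1) * (i : ℕ).factorial * (j : ℕ).factorial)

theorem expMatrix_isHermitian (k : ℕ) : (expMatrix k).IsHermitian := by
  ext i j
  simp only [expMatrix, Matrix.conjTranspose_apply, Matrix.of_apply, star_trivial]
  congr 1
  ring

/-- Since `∫₀¹ t^{i+j} dt = 1/(i+j+1)`, this is the Gram matrix of the functions `t^i/i!`. -/
theorem dotProduct_expMatrix (k : ℕ) (x : Fin k → ℝ) :
    star x ⬝ᵥ (expMatrix k).mulVec x =
      ∫ t in (0 : ℝ)..1, (∑ i, x i / (i : ℕ).factorial * t ^ (i : ℕ)) ^ 2 := by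
  simp only [sq, Finset.sum_mul_sum]
  rw [intervalIntegral.integral_finsetSum fun i _ => Continuous.intervalIntegrable (by fun_prop) _ _]
  simp only [dotProduct, Matrix.mulVec, Finset.mul_sum]
  refine Finset.sum_congr rfl fun i _ => ?_
  rw [intervalIntegral.integral_finsetSum fun i _ => Continuous.intervalIntegrable (by fun_prop) _ _]
  refine Finset.sum_congr rfl fun j _ => ?_
  have : ∀ t : ℝ, x i / (i : ℕ).factorial * t ^ (i : ℕ) * (x j / (j : ℕ).factorial * t ^ (j : ℕ)) =
      x i / (i : ℕ).factorial * (x j / (j : ℕ).factorial) * t ^ ((i : ℕ) + j) := fun t => by ring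
  simp only [this, intervalIntegral.integral_const_mul, integral_pow, expMatrix, Matrix.of_apply,
    star_trivial]
  push_cast
  have h1 : ((i : ℕ).factorial : ℝ) ≠ 0 := by positivity
  have h2 : ((j : ℕ).factorial : ℝ) ≠ 0 := by positivity
  have h3 : ((i : ℕ) + (j : ℕ) + 1 : ℝ) ≠ 0 := by positivity
  simp
  field_simp

theorem expMatrix_posDef (k : ℕ) : (expMatrix k).PosDef := by
  refine Matrix.PosDef.of_dotProduct_mulVec_pos (expMatrix_isHermitian k) fun x hx => ?_
  rw [dotProduct_expMatrix]
  refine intervalIntegral.integral_pos one_pos (by fun_prop) (fun t _ => sq_nonneg _) ?_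
  -- Otherwise the polynomial vanishes on all of `[0, 1]`, so it is zero and so are its
  -- coefficients.
  by_contra! h
  set P : ℝ[X] := ∑ i : Fin k, C (x i / (i : ℕ).factorial) * X ^ (i : ℕ) with hP
  have hP0 : P = 0 := by
    refine Polynomial.eq_zero_of_infinite_isRoot P
      ((Set.Icc_infinite (zero_lt_one' ℝ)).mono fun t ht => ?_)
    have := h t ht
    have h0 := pow_eq_zero_iff (two_ne_zero) |>.1 (le_antisymm this (sq_nonneg _))
    simpa [hP, Polynomial.eval_finsetSum] using h0
  refine hx (funext fun i => ?_)
  have hc : P.coeff i = x i / (i : ℕ).factorial := by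
    simp only [hP, Polynomial.finsetSum_coeff, Polynomial.coeff_C_mul_X_pow]
    rw [Finset.sum_eq_single i] <;> simp +contextual [Fin.val_inj, eq_comm]
  rw [hP0, Polynomial.coeff_zero, eq_comm, div_eq_zero_iff] at hc
  exact hc.resolve_right (by positivity)

/-- The recursion `energyGamma_step` runs along the antidiagonals `i + j = const`, starting from `j
= 0`, and in this range it meets only coefficients of the exponential. -/
theorem energyGamma_eq_of_le {R : ℝ[X]} {p : ℕ}
    (hp : ∀ k ≤ p, R.coeff k = 1 / (k.factorial : ℝ)) {i j : ℕ} (hji : j ≤ i)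
    (hij : i + j + 1 ≤ p) :
    energyGamma R i j = -(1 / (((i : ℝ) + j + 1) * i.factorial * j.factorial)) := by
  induction j generalizing i with
  | zero =>
    have h := energy_coeff_zero R i
    rw [hp _ (by omega), hp 0 (by omega)] at h
    rw [eq_neg_iff_add_eq_zero, ← neg_eq_iff_eq_neg.2 h]
    simp [Nat.factorial_succ]
  | succ n ih =>
    have h := energyGamma_step R (m := i) (n := n) (by omega)
    rw [ih (by omega) (by omega), hp _ (by omega), hp _ (by omega)] at h
    rw [eq_sub_of_add_eq h, Nat.factorial_succ, Nat.factorial_succ]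
    push_cast
    have h1 : (i.factorial : ℝ) ≠ 0 := by positivity
    have h2 : (n.factorial : ℝ) ≠ 0 := by positivity
    have h3 : (i : ℝ) + 1 + n + 1 ≠ 0 := by positivity
    have h4 : (i : ℝ) + (n + 1) + 1 ≠ 0 := by positivity
    field_simp
    ring

theorem leadingMatrix_apply_eq {R : ℝ[X]} {p : ℕ}
    (hp : ∀ k ≤ p, R.coeff k = 1 / (k.factorial : ℝ)) (i j : Fin (leadingIndex R))
    (hij : (i : ℕ) + j + 1 ≤ p) :
    leadingMatrix R i j = -expMatrix _ i j := by
  simp only [leadingMatrix, expMatrix, Matrix.of_apply]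
  rcases le_total (j : ℕ) i with h | h
  · exact energyGamma_eq_of_le hp h hij
  · rw [energyGamma_comm, energyGamma_eq_of_le hp h (by omega)]
    congr 2
    ring

theorem leadingMatrix_isHermitian (R : ℝ[X]) : (leadingMatrix R).IsHermitian := by
  ext i j
  simp [leadingMatrix, energyGamma_comm R i j]

theorem lastDiag_isHermitian (n : ℕ) (c : ℝ) : (lastDiag n c).IsHermitian :=
  Matrix.isHermitian_diagonal _

/-- Only the corner has `i + j + 1 = 2k* - 1`, which may be `p + 1`; every other entry has `i + j +
1 ≤ 2k* - 2 ≤ p`. -/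
theorem leadingMatrix_sub_lastDiag_apply {R : ℝ[X]} {p : ℕ}
    (hp : ∀ k ≤ p, R.coeff k = 1 / (k.factorial : ℝ)) (hk : 2 * leadingIndex R ≤ p + 2) (c : ℝ)
    (i j : Fin (leadingIndex R)) (hij : ¬ ((i : ℕ) + 1 = leadingIndex R ∧ i = j)) :
    -(leadingMatrix R - lastDiag (leadingIndex R) c) i j = expMatrix _ i j := by
  have hi := i.2
  have hj := j.2
  have hij' : ¬ ((i : ℕ) + 1 = leadingIndex R ∧ (i : ℕ) = j) := by simpa [Fin.ext_iff] using hij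
  rw [Matrix.sub_apply, leadingMatrix_apply_eq hp i j (by omega), lastDiag, Matrix.diagonal_apply]
  split_ifs with h1 h2
  · exact absurd ⟨h2, h1⟩ hij
  all_goals simp

theorem exists_isDispersiveBound {R : ℝ[X]} {p : ℕ}
    (hp : ∀ k ≤ p, R.coeff k = 1 / (k.factorial : ℝ)) (hk : 2 * leadingIndex R ≤ p + 2) :
    ∃ μ₀ : ℝ, IsDispersiveBound R μ₀ := by
  -- This value turns the corner entry into that of the exponential, so that the matrix is exactly
  -- `-expMatrix`.
  refine ⟨energyGamma R (leadingIndex R - 1) (leadingIndex R - 1) +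
    1 / ((((leadingIndex R - 1 : ℕ) : ℝ) + (leadingIndex R - 1 : ℕ) + 1) *
    (leadingIndex R - 1).factorial * (leadingIndex R - 1).factorial), ?_⟩
  unfold IsDispersiveBound
  convert (expMatrix_posDef _).posSemidef using 1
  ext i j
  rw [Matrix.neg_apply]
  by_cases hij : (i : ℕ) + 1 = leadingIndex R ∧ i = j
  · obtain ⟨h1, rfl⟩ := hij
    have h2 : leadingIndex R - 1 = i := by omega
    simp only [leadingMatrix, lastDiag, expMatrix, Matrix.sub_apply, Matrix.of_apply,
      Matrix.diagonal_apply_eq, if_pos h1, h2]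
    ring
  · exact leadingMatrix_sub_lastDiag_apply hp hk _ i j hij

/-- Here even the corner has `i + j + 1 = 2k* - 1 ≤ p`. The term with `0` gives both parities the
same form. -/
theorem posDef_of_odd {R : ℝ[X]} {p : ℕ}
    (hp : ∀ k ≤ p, R.coeff k = 1 / (k.factorial : ℝ)) (hk : 2 * leadingIndex R ≤ p + 1) :
    (-(leadingMatrix R - lastDiag (leadingIndex R) 0)).PosDef := by
  convert expMatrix_posDef (leadingIndex R) using 1
  ext i j
  have hi := i.2
  have hj := j.2
  rw [Matrix.neg_apply, Matrix.sub_apply, leadingMatrix_apply_eq hp i j (by omega)]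
  simp [lastDiag]

theorem posDef_of_isDispersiveBound {R : ℝ[X]} {p : ℕ}
    (hp : ∀ k ≤ p, R.coeff k = 1 / (k.factorial : ℝ)) (hk : 2 * leadingIndex R ≤ p + 2)
    {μ μ₀ : ℝ} (hμ₀ : IsDispersiveBound R μ₀) (hμ : μ₀ < μ) :
    (-(leadingMatrix R - lastDiag (leadingIndex R) μ)).PosDef := by
  refine Matrix.PosDef.of_dotProduct_mulVec_pos
    ((leadingMatrix_isHermitian R).sub (lastDiag_isHermitian _ _)).neg fun x hx => ?_
  have hsplit : -(leadingMatrix R - lastDiag (leadingIndex R) μ) =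
      -(leadingMatrix R - lastDiag (leadingIndex R) μ₀) + lastDiag (leadingIndex R) (μ - μ₀) := by
    ext i j
    simp only [lastDiag, Matrix.neg_apply, Matrix.sub_apply, Matrix.add_apply,
      Matrix.diagonal_apply]
    split_ifs <;> ring
  have h1 := Matrix.PosSemidef.dotProduct_mulVec_nonneg hμ₀ x
  have h2 : star x ⬝ᵥ (lastDiag (leadingIndex R) (μ - μ₀)).mulVec x =
      ∑ i : Fin (leadingIndex R),
        (if (i : ℕ) + 1 = leadingIndex R then μ - μ₀ else 0) * x i ^ 2 := by
    simp only [dotProduct, lastDiag, Matrix.mulVec_diagonal, star_trivial, Pi.star_apply]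
    exact Finset.sum_congr rfl fun i _ => by ring
  have hterm : ∀ i : Fin (leadingIndex R),
      0 ≤ (if (i : ℕ) + 1 = leadingIndex R then μ - μ₀ else 0) * x i ^ 2 := fun i => by
    split_ifs
    · exact mul_nonneg (sub_pos.2 hμ).le (sq_nonneg _)
    · simp
  -- A vector with zero last coordinate does not see the corner, so the quadratic form is that of
  -- `expMatrix`. Otherwise the semidefinite form at `μ₀` gains `μ - μ₀` times a positive square.
  by_cases hlast : ∀ i : Fin (leadingIndex R), (i : ℕ) + 1 = leadingIndex R → x i = 0
  · convert (expMatrix_posDef (leadingIndex R)).dotProduct_mulVec_pos hx using 1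
    simp only [dotProduct, Matrix.mulVec, Finset.mul_sum]
    refine Finset.sum_congr rfl fun i _ => Finset.sum_congr rfl fun j _ => ?_
    by_cases hij : (i : ℕ) + 1 = leadingIndex R ∧ i = j
    · simp [hlast i hij.1]
    · rw [Matrix.neg_apply, leadingMatrix_sub_lastDiag_apply hp hk μ i j hij]
  · push Not at hlast
    obtain ⟨i, hi, hxi⟩ := hlast
    rw [hsplit, Matrix.add_mulVec, dotProduct_add, h2]
    refine add_pos_of_nonneg_of_pos h1 (Finset.sum_pos' (fun i _ => hterm i)
      ⟨i, Finset.mem_univ _, ?_⟩)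
    rw [if_pos hi]
    exact mul_pos (sub_pos.2 hμ) (by positivity)

/-! ### The dissipation form -/

section Form

variable {V : Type u} [NormedAddCommGroup V] [InnerProductSpace ℝ V]

/-- The form `⟦v, w⟧ = -⟪Z v, w⟫ - ⟪v, Z w⟫`. -/
noncomputable def dissForm (Z : V →L[ℝ] V) : LinearMap.BilinForm ℝ V :=
  LinearMap.mk₂ ℝ (fun v w => -⟪Z v, w⟫_ℝ - ⟪v, Z w⟫_ℝ)
    (fun v v' w => by simp only [map_add, inner_add_left]; ring)
    (fun c v w => by simp only [map_smul, real_inner_smul_left, smul_eq_mul]; ring)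
    (fun v w w' => by simp only [map_add, inner_add_right]; ring)
    (fun c v w => by simp only [map_smul, real_inner_smul_right, smul_eq_mul]; ring)

theorem dissForm_apply (Z : V →L[ℝ] V) (v w : V) :
    dissForm Z v w = -⟪Z v, w⟫_ℝ - ⟪v, Z w⟫_ℝ := rfl

theorem dissForm_comm (Z : V →L[ℝ] V) (v w : V) : dissForm Z v w = dissForm Z w v := by
  rw [dissForm_apply, dissForm_apply, real_inner_comm, real_inner_comm (Z w)]
  ring

theorem dissForm_self (Z : V →L[ℝ] V) (v : V) : dissForm Z v v = -(2 * ⟪Z v, v⟫_ℝ) := by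
  rw [dissForm_apply, real_inner_comm (Z v)]
  ring

theorem dissForm_self_nonneg {Z : V →L[ℝ] V} (hZ : IsSemiNegative Z) (v : V) :
    0 ≤ dissForm Z v v := by
  rw [dissForm_self]
  linarith [hZ v]

/-- The seminorm of the dissipation form. -/
noncomputable def dissNorm (Z : V →L[ℝ] V) (v : V) : ℝ := √(dissForm Z v v)

theorem dissNorm_nonneg (Z : V →L[ℝ] V) (v : V) : 0 ≤ dissNorm Z v := Real.sqrt_nonneg _

theorem dissNorm_sq {Z : V →L[ℝ] V} (hZ : IsSemiNegative Z) (v : V) :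
    dissNorm Z v ^ 2 = dissForm Z v v := Real.sq_sqrt (dissForm_self_nonneg hZ v)

theorem abs_dissForm_le {Z : V →L[ℝ] V} (hZ : IsSemiNegative Z) (v w : V) :
    |dissForm Z v w| ≤ dissNorm Z v * dissNorm Z w := by
  refine abs_le_of_sq_le_sq ?_ (mul_nonneg (dissNorm_nonneg _ _) (dissNorm_nonneg _ _))
  rw [mul_pow, dissNorm_sq hZ, dissNorm_sq hZ]
  exact LinearMap.BilinForm.apply_sq_le_of_symm _ (dissForm_self_nonneg hZ)
    ⟨fun v w => dissForm_comm Z v w⟩ v w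

/-- The seminorm gains only the square root of `‖Z‖`; this is why smallness is measured by `s` with
`2‖Z‖ ≤ s²`. -/
theorem dissNorm_le {Z : V →L[ℝ] V} {s : ℝ} (hs : 0 ≤ s) (h : 2 * ‖Z‖ ≤ s ^ 2) (v : V) :
    dissNorm Z v ≤ s * ‖v‖ := by
  refine Real.sqrt_le_iff.2 ⟨by positivity, ?_⟩
  rw [dissForm_self]
  have h1 : -⟪Z v, v⟫_ℝ ≤ ‖Z‖ * ‖v‖ * ‖v‖ :=
    (neg_le_abs _).trans ((abs_real_inner_le_norm _ _).trans
      (mul_le_mul_of_nonneg_right (Z.le_opNorm v) (norm_nonneg v)))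
  nlinarith [mul_le_mul_of_nonneg_right h (sq_nonneg ‖v‖)]

theorem abs_dissForm_le_of_le {Z : V →L[ℝ] V} (hZ : IsSemiNegative Z) {v w : V} {a b : ℝ}
    (hv : dissNorm Z v ≤ a) (hw : dissNorm Z w ≤ b) : |dissForm Z v w| ≤ a * b :=
  (abs_dissForm_le hZ v w).trans
    (mul_le_mul hv hw (dissNorm_nonneg _ _) ((dissNorm_nonneg _ _).trans hv))

/-- A perturbation of relative size `E s` changes the form by a factor of order `s`. -/
theorem abs_dissForm_sub_le {Z : V →L[ℝ] V} (hZ : IsSemiNegative Z) {x x' y y' : V} {q s E : ℝ}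
    (hs0 : 0 ≤ s) (hs1 : s ≤ 1) (hy : dissNorm Z y ≤ q)
    (hy' : dissNorm Z y' ≤ q) (hx : dissNorm Z (x - y) ≤ E * s * q)
    (hx' : dissNorm Z (x' - y') ≤ E * s * q) :
    |dissForm Z x x' - dissForm Z y y'| ≤ (2 * E + E ^ 2) * s * q ^ 2 := by
  have e : dissForm Z x x' - dissForm Z y y' = dissForm Z y (x' - y') + dissForm Z (x - y) y' +
      dissForm Z (x - y) (x' - y') := by
    simp only [map_sub, LinearMap.sub_apply]
    ring
  have h1 := abs_dissForm_le_of_le hZ hy hx'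
  have h2 := abs_dissForm_le_of_le hZ hx hy'
  have h3 := abs_dissForm_le_of_le hZ hx hx'
  have h4 : s ^ 2 * (E ^ 2 * q ^ 2) ≤ s * (E ^ 2 * q ^ 2) :=
    mul_le_mul_of_nonneg_right (by nlinarith) (by positivity)
  rw [e]
  refine (abs_add_three _ _ _).trans ?_
  nlinarith

/-! ### Adjoints, scaling and powers of operators. -/

theorem IsAdjointOf.symm {L Lt : V →L[ℝ] V} (h : IsAdjointOf Lt L) : IsAdjointOf L Lt :=
  fun v w => by rw [real_inner_comm, ← h w v, real_inner_comm]

theorem IsAdjointOf.pow {L Lt : V →L[ℝ] V} (h : IsAdjointOf Lt L) (n : ℕ) :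
    IsAdjointOf (Lt ^ n) (L ^ n) := by
  induction n with
  | zero => exact fun v w => rfl
  | succ n ih =>
    intro v w
    rw [pow_succ, pow_succ', mul_apply_eq_comp, mul_apply_eq_comp, ih, h]

theorem IsAdjointOf.smul {L Lt : V →L[ℝ] V} (h : IsAdjointOf Lt L) (c : ℝ) :
    IsAdjointOf (c • Lt) (c • L) := fun v w => by
  simp only [_root_.smul_apply, real_inner_smul_left, real_inner_smul_right, h v w]

theorem IsSemiNegative.smul {L : V →L[ℝ] V} (h : IsSemiNegative L) {c : ℝ} (hc : 0 ≤ c) :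
    IsSemiNegative (c • L) := fun v => by
  rw [_root_.smul_apply, real_inner_smul_left]
  exact mul_nonpos_of_nonneg_of_nonpos hc (h v)

theorem IsAdjointOf.norm_le {L Lt : V →L[ℝ] V} (h : IsAdjointOf Lt L) : ‖Lt‖ ≤ ‖L‖ := by
  refine Lt.opNorm_le_bound (norm_nonneg _) fun v => ?_
  have h1 : ‖Lt v‖ ^ 2 ≤ ‖L‖ * ‖v‖ * ‖Lt v‖ := by
    rw [← real_inner_self_eq_norm_sq, ← h]
    calc ⟪L (Lt v), v⟫_ℝ ≤ ‖L (Lt v)‖ * ‖v‖ := real_inner_le_norm _ _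
      _ ≤ ‖L‖ * ‖Lt v‖ * ‖v‖ := mul_le_mul_of_nonneg_right (L.le_opNorm _) (norm_nonneg _)
      _ = _ := by ring
  rcases (norm_nonneg (Lt v)).eq_or_lt with h0 | h0
  · rw [← h0]
    positivity
  · exact le_of_mul_le_mul_right (by linarith) h0

theorem norm_pow_apply_le {T : V →L[ℝ] V} {s : ℝ} (hT : ‖T‖ ≤ s) (n : ℕ) (v : V) :
    ‖(T ^ n) v‖ ≤ s ^ n * ‖v‖ := by
  induction n with
  | zero => simp
  | succ n ih =>
    rw [pow_succ', mul_apply_eq_comp, pow_succ', mul_assoc]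
    exact (T.le_of_opNorm_le hT _).trans
      (mul_le_mul_of_nonneg_left ih ((norm_nonneg _).trans hT))

/-! ### The superviscosity term -/

theorem inner_superviscosity {Z Zt : V →L[ℝ] V} (h : IsAdjointOf Zt Z) (k : ℕ) (μ ν : ℝ)
    (v w : V) : ⟪superviscosity k μ ν Z Zt v, w⟫_ℝ =
      μ * ⟪(Z ^ k) v, (Z ^ (k - 1)) w⟫_ℝ + ν * ⟪(Z ^ k) v, (Z ^ k) w⟫_ℝ := by
  simp only [superviscosity, _root_.add_apply, _root_.smul_apply, mul_apply_eq_comp,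
    inner_add_left, real_inner_smul_left, (h.pow _).symm _ w]

/-- The modified method is `R` applied to `Z + W`, so its energy identity involves the form of `Z +
W`. -/
theorem dissForm_add_superviscosity {Z Zt : V →L[ℝ] V} (h : IsAdjointOf Zt Z) {k : ℕ}
    (hk : 1 ≤ k) (μ ν : ℝ) (v w : V) :
    dissForm (Z + superviscosity k μ ν Z Zt) v w = dissForm Z v w +
      (μ * dissForm Z ((Z ^ (k - 1)) v) ((Z ^ (k - 1)) w)
        - 2 * ν * ⟪(Z ^ k) v, (Z ^ k) w⟫_ℝ) := by
  have hZ : ∀ v, Z ((Z ^ (k - 1)) v) = (Z ^ k) v := fun v => by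
    rw [← mul_apply_eq_comp, ← pow_succ', Nat.sub_add_cancel hk]
  simp only [dissForm_apply, _root_.add_apply, inner_add_left, inner_add_right, hZ,
    inner_superviscosity h]
  rw [real_inner_comm (superviscosity k μ ν Z Zt w), inner_superviscosity h,
    real_inner_comm ((Z ^ (k - 1)) v), real_inner_comm ((Z ^ k) w) ((Z ^ k) v)]
  ring

/-- This is the effect for which `W` is designed: `μ` shifts the corner entry of `Γ*`, and `ν`
shifts `β_{k*}`. -/
theorem two_mul_inner_superviscosity {Z Zt : V →L[ℝ] V} (h : IsAdjointOf Zt Z) {k : ℕ}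
    (hk : 1 ≤ k) (μ ν : ℝ) (v : V) :
    2 * ⟪superviscosity k μ ν Z Zt v, v⟫_ℝ =
      -(μ * dissForm Z ((Z ^ (k - 1)) v) ((Z ^ (k - 1)) v)) + 2 * ν * ‖(Z ^ k) v‖ ^ 2 := by
  rw [inner_superviscosity h, dissForm_self, ← mul_apply_eq_comp, ← pow_succ',
    Nat.sub_add_cancel hk, real_inner_self_eq_norm_sq]
  ring

/-- A step that is small compared with `s`. -/
structure IsSmallStep (Z Zt : V →L[ℝ] V) (s : ℝ) : Prop where
  semiNegative : IsSemiNegative Z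
  adjoint : IsAdjointOf Zt Z
  nonneg : 0 ≤ s
  le_one : s ≤ 1
  norm_le_sq : 2 * ‖Z‖ ≤ s ^ 2

theorem IsSmallStep.norm_le {Z Zt : V →L[ℝ] V} {s : ℝ} (h : IsSmallStep Z Zt s) : ‖Z‖ ≤ s := by
  nlinarith [h.norm_le_sq, h.nonneg, h.le_one]

theorem IsSmallStep.norm_pow_le {Z Zt : V →L[ℝ] V} {s : ℝ} (h : IsSmallStep Z Zt s) (n : ℕ)
    (v : V) : ‖(Z ^ n) v‖ ≤ ‖v‖ := by
  simpa using norm_pow_apply_le (h.norm_le.trans h.le_one) n v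

theorem IsSmallStep.norm_pow_le_mul {Z Zt : V →L[ℝ] V} {s : ℝ} (h : IsSmallStep Z Zt s) {n : ℕ}
    (hn : n ≠ 0) (v : V) : ‖(Z ^ n) v‖ ≤ s * ‖v‖ :=
  (norm_pow_apply_le h.norm_le n v).trans (mul_le_mul_of_nonneg_right
    (pow_le_of_le_one h.nonneg h.le_one hn) (norm_nonneg v))

theorem IsSmallStep.transpose_norm_pow_le_mul {Z Zt : V →L[ℝ] V} {s : ℝ} (h : IsSmallStep Z Zt s)
    {n : ℕ} (hn : n ≠ 0) (v : V) : ‖(Zt ^ n) v‖ ≤ s * ‖v‖ :=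
  (norm_pow_apply_le (h.adjoint.norm_le.trans h.norm_le) n v).trans (mul_le_mul_of_nonneg_right
    (pow_le_of_le_one h.nonneg h.le_one hn) (norm_nonneg v))

/-- The factor `s` comes from the powers of `Zt` in front of `Z ^ k`. For `k = 1` the `μ`-term has
no such power, which explains `hkμ`. -/
theorem IsSmallStep.norm_superviscosity_le {Z Zt : V →L[ℝ] V} {s : ℝ} (h : IsSmallStep Z Zt s)
    {k : ℕ} (hk : 1 ≤ k) {μ : ℝ} (hkμ : 2 ≤ k ∨ μ = 0) (ν : ℝ) (v : V) :
    ‖superviscosity k μ ν Z Zt v‖ ≤ (|μ| + |ν|) * s * ‖(Z ^ k) v‖ := by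
  have h1 : ‖μ • (Zt ^ (k - 1)) ((Z ^ k) v)‖ ≤ |μ| * (s * ‖(Z ^ k) v‖) := by
    rw [norm_smul, Real.norm_eq_abs]
    rcases hkμ with hk | rfl
    · exact mul_le_mul_of_nonneg_left (h.transpose_norm_pow_le_mul (by omega) _) (abs_nonneg _)
    · simp
  have h2 : ‖ν • (Zt ^ k) ((Z ^ k) v)‖ ≤ |ν| * (s * ‖(Z ^ k) v‖) := by
    rw [norm_smul, Real.norm_eq_abs]
    exact mul_le_mul_of_nonneg_left (h.transpose_norm_pow_le_mul (by omega) _) (abs_nonneg _)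
  simp only [superviscosity, _root_.add_apply, _root_.smul_apply, mul_apply_eq_comp]
  refine (norm_add_le _ _).trans ?_
  linarith

/-! ### The leading energy -/

/-- The square root of `∑_{i<k} ⟦Z^i v, Z^i v⟧ + ‖Z^k v‖²`. -/
noncomputable def leadingNorm (Z : V →L[ℝ] V) (k : ℕ) (v : V) : ℝ :=
  √(∑ i ∈ Finset.range k, dissForm Z ((Z ^ i) v) ((Z ^ i) v) + ‖(Z ^ k) v‖ ^ 2)

theorem leadingNorm_nonneg (Z : V →L[ℝ] V) (k : ℕ) (v : V) : 0 ≤ leadingNorm Z k v :=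
  Real.sqrt_nonneg _

theorem leadingNorm_sq {Z : V →L[ℝ] V} (hZ : IsSemiNegative Z) (k : ℕ) (v : V) :
    leadingNorm Z k v ^ 2 =
      ∑ i ∈ Finset.range k, dissForm Z ((Z ^ i) v) ((Z ^ i) v) + ‖(Z ^ k) v‖ ^ 2 :=
  Real.sq_sqrt (add_nonneg (Finset.sum_nonneg fun _ _ => dissForm_self_nonneg hZ _)
    (sq_nonneg _))

theorem norm_pow_le_leadingNorm {Z : V →L[ℝ] V} (hZ : IsSemiNegative Z) (k : ℕ) (v : V) :
    ‖(Z ^ k) v‖ ≤ leadingNorm Z k v := by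
  refine abs_le_of_sq_le_sq' ?_ (leadingNorm_nonneg Z k v) |>.2
  rw [leadingNorm_sq hZ]
  exact le_add_of_nonneg_left (Finset.sum_nonneg fun _ _ => dissForm_self_nonneg hZ _)

theorem IsSmallStep.norm_pow_add_le {Z Zt : V →L[ℝ] V} {s : ℝ} (h : IsSmallStep Z Zt s)
    (k j : ℕ) (v : V) : ‖(Z ^ (k + j)) v‖ ≤ leadingNorm Z k v := by
  rw [add_comm, pow_add, mul_apply_eq_comp]
  exact (h.norm_pow_le _ _).trans (norm_pow_le_leadingNorm h.semiNegative k v)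

theorem IsSmallStep.norm_pow_add_le_mul {Z Zt : V →L[ℝ] V} {s : ℝ} (h : IsSmallStep Z Zt s)
    (k : ℕ) {j : ℕ} (hj : j ≠ 0) (v : V) :
    ‖(Z ^ (k + j)) v‖ ≤ s * leadingNorm Z k v := by
  rw [add_comm, pow_add, mul_apply_eq_comp]
  exact (h.norm_pow_le_mul hj _).trans
    (mul_le_mul_of_nonneg_left (norm_pow_le_leadingNorm h.semiNegative k v) h.nonneg)

theorem IsSmallStep.dissNorm_le_mul_of_norm_le {Z Zt : V →L[ℝ] V} {s : ℝ} (h : IsSmallStep Z Zt s)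
    {v : V} {a : ℝ} (hv : ‖v‖ ≤ a) : dissNorm Z v ≤ s * a :=
  (dissNorm_le h.nonneg h.norm_le_sq v).trans (mul_le_mul_of_nonneg_left hv h.nonneg)

/-- Beyond the leading block the form is dominated by `‖Z ^ k v‖` with a factor `s` to spare; inside
it, `dissNorm_pow_le` gains nothing. -/
theorem IsSmallStep.dissNorm_pow_le_mul {Z Zt : V →L[ℝ] V} {s : ℝ} (h : IsSmallStep Z Zt s)
    {k i : ℕ} (hi : k ≤ i) (v : V) :
    dissNorm Z ((Z ^ i) v) ≤ s * leadingNorm Z k v := by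
  obtain ⟨j, rfl⟩ := Nat.exists_eq_add_of_le hi
  exact h.dissNorm_le_mul_of_norm_le (h.norm_pow_add_le k j v)

theorem IsSmallStep.dissNorm_pow_le {Z Zt : V →L[ℝ] V} {s : ℝ} (h : IsSmallStep Z Zt s)
    (k i : ℕ) (v : V) : dissNorm Z ((Z ^ i) v) ≤ leadingNorm Z k v := by
  rcases lt_or_ge i k with hi | hi
  · refine abs_le_of_sq_le_sq' ?_ (leadingNorm_nonneg Z k v) |>.2
    rw [leadingNorm_sq h.semiNegative, dissNorm_sq h.semiNegative]
    exact le_add_of_le_of_nonneg (Finset.single_le_sum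
      (f := fun i => dissForm Z ((Z ^ i) v) ((Z ^ i) v))
      (fun _ _ => dissForm_self_nonneg h.semiNegative _) (Finset.mem_range.2 hi)) (sq_nonneg _)
  · exact (h.dissNorm_pow_le_mul hi v).trans
      (mul_le_of_le_one_left (leadingNorm_nonneg Z k v) h.le_one)

end Form

/-! ### Strong stability -/

theorem energyBeta_eq_zero {R : ℝ[X]} {j : ℕ} (hj : 1 ≤ j) (hjk : j < leadingIndex R) :
    energyBeta R j = 0 := by
  by_contra h
  exact Nat.notMem_of_lt_sInf hjk ⟨hj, h⟩

/-- The sum of the absolute values of the coefficients of the energy identity. -/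
noncomputable def energySize (R : ℝ[X]) (n : ℕ) : ℝ :=
  ∑ j ∈ Finset.Icc 1 n, |energyBeta R j| +
    ∑ i ∈ Finset.range n, ∑ j ∈ Finset.range n, |energyGamma R i j|

theorem energySize_nonneg (R : ℝ[X]) (n : ℕ) : 0 ≤ energySize R n :=
  add_nonneg (Finset.sum_nonneg fun _ _ => abs_nonneg _)
    (Finset.sum_nonneg fun _ _ => Finset.sum_nonneg fun _ _ => abs_nonneg _)

theorem mul_le_mul_add_abs_mul {a x y ε : ℝ} (h : |x - y| ≤ ε) : a * x ≤ a * y + |a| * ε := by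
  have h1 : a * (x - y) ≤ |a| * ε :=
    (le_abs_self _).trans (by rw [abs_mul]; exact mul_le_mul_of_nonneg_left h (abs_nonneg a))
  linarith

/-- If the quantities in the energy identity agree up to `ε` with their leading parts, then so
does their sum. -/
theorem energy_sum_le {R : ℝ[X]} (hR : IsConsistent R) {n : ℕ} (hn : leadingIndex R ≤ n)
    (N : ℕ → ℝ) (t T : ℕ → ℕ → ℝ) (N₀ d ε : ℝ)
    (hN : ∀ j ≤ n, leadingIndex R ≤ j → |N j - if j = leadingIndex R then N₀ else 0| ≤ ε)
    (ht : ∀ i < n, ∀ j < n, |t i j - ((if i < leadingIndex R ∧ j < leadingIndex R then T i j else 0)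
      + if i = 0 ∧ j = 0 then d else 0)| ≤ ε) :
    ∑ j ∈ Finset.Icc 1 n, energyBeta R j * N j +
        ∑ i ∈ Finset.range n, ∑ j ∈ Finset.range n, energyGamma R i j * t i j ≤
      energyBeta R (leadingIndex R) * N₀ +
        ∑ i ∈ Finset.range (leadingIndex R), ∑ j ∈ Finset.range (leadingIndex R),
          energyGamma R i j * T i j - d + energySize R n * ε := by
  set k := leadingIndex R with hk
  have hk1 : 1 ≤ k := (leadingIndex_spec R hR.2).1
  have h1 : ∑ j ∈ Finset.Icc 1 n, energyBeta R j * N j ≤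
      energyBeta R k * N₀ + ∑ j ∈ Finset.Icc 1 n, |energyBeta R j| * ε := by
    calc ∑ j ∈ Finset.Icc 1 n, energyBeta R j * N j
        ≤ ∑ j ∈ Finset.Icc 1 n, (energyBeta R j * (if j = k then N₀ else 0)
          + |energyBeta R j| * ε) := by
          refine Finset.sum_le_sum fun j hj => ?_
          rw [Finset.mem_Icc] at hj
          -- Below the leading index `β_j = 0`, so nothing needs to be known about `N j`.
          rcases lt_or_ge j k with hjk | hjk
          · simp [energyBeta_eq_zero hj.1 hjk]
          · exact mul_le_mul_add_abs_mul (hN j hj.2 hjk)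
      _ = _ := by
          rw [Finset.sum_add_distrib]
          simp only [mul_ite, mul_zero, Finset.sum_ite_eq', Finset.mem_Icc, hk1, hn, and_self,
            if_true]
  have h2 : ∑ i ∈ Finset.range n, ∑ j ∈ Finset.range n, energyGamma R i j * t i j ≤
      ∑ i ∈ Finset.range k, ∑ j ∈ Finset.range k, energyGamma R i j * T i j - d +
        ∑ i ∈ Finset.range n, ∑ j ∈ Finset.range n, |energyGamma R i j| * ε := by
    have e1 : ∑ i ∈ Finset.range n, ∑ j ∈ Finset.range n,
        energyGamma R i j * (if i < k ∧ j < k then T i j else 0) =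
        ∑ i ∈ Finset.range k, ∑ j ∈ Finset.range k, energyGamma R i j * T i j := by
      have hsub : Finset.range k ⊆ Finset.range n := Finset.range_subset_range.2 hn
      symm
      calc ∑ i ∈ Finset.range k, ∑ j ∈ Finset.range k, energyGamma R i j * T i j
          = ∑ i ∈ Finset.range k, ∑ j ∈ Finset.range n,
              energyGamma R i j * (if i < k ∧ j < k then T i j else 0) := by
            refine Finset.sum_congr rfl fun i hi => ?_
            rw [← Finset.sum_subset hsub]
            · refine Finset.sum_congr rfl fun j hj => ?_
              rw [if_pos ⟨Finset.mem_range.1 hi, Finset.mem_range.1 hj⟩]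
            · intro j _ hj
              rw [if_neg fun h => hj (Finset.mem_range.2 h.2), mul_zero]
        _ = _ := by
            refine Finset.sum_subset hsub fun i _ hi => Finset.sum_eq_zero fun j _ => ?_
            rw [if_neg fun h => hi (Finset.mem_range.2 h.1), mul_zero]
    -- `γ₀₀ = -α₁ α₀ = -1`, so the extra term `d` at `(0, 0)` appears with a minus sign.
    have e2 : ∑ i ∈ Finset.range n, ∑ j ∈ Finset.range n,
        energyGamma R i j * (if i = 0 ∧ j = 0 then d else 0) = -d := by
      have h0 : (0 : ℕ) ∈ Finset.range n := Finset.mem_range.2 (by omega)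
      rw [Finset.sum_eq_single_of_mem 0 h0, Finset.sum_eq_single_of_mem 0 h0]
      · have := energy_coeff_zero R 0
        rw [zero_add, hR.1, hR.2] at this
        rw [if_pos ⟨rfl, rfl⟩]
        linear_combination d * this
      · intro j _ hj
        simp [hj]
      · intro i _ hi
        simp [hi]
    calc ∑ i ∈ Finset.range n, ∑ j ∈ Finset.range n, energyGamma R i j * t i j
        ≤ ∑ i ∈ Finset.range n, ∑ j ∈ Finset.range n,
            (energyGamma R i j * ((if i < k ∧ j < k then T i j else 0)
              + if i = 0 ∧ j = 0 then d else 0) + |energyGamma R i j| * ε) :=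
          Finset.sum_le_sum fun i hi => Finset.sum_le_sum fun j hj =>
            mul_le_mul_add_abs_mul (ht i (Finset.mem_range.1 hi) j (Finset.mem_range.1 hj))
      _ = _ := by
          simp only [mul_add, Finset.sum_add_distrib, e1, e2]
          ring
  rw [energySize, add_mul, Finset.sum_mul]
  simp only [Finset.sum_mul]
  linarith

/-- The leading part of the energy identity is uniformly negative. -/
theorem exists_leading_part_le {R : ℝ[X]} (hR : IsConsistent R) {μ ν : ℝ}
    (hν : ν < -energyBeta R (leadingIndex R) / 2)
    (hμ : (-(leadingMatrix R - lastDiag (leadingIndex R) μ)).PosDef) :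
    ∃ c : ℝ, 0 < c ∧ ∀ (V : Type u) [NormedAddCommGroup V] [InnerProductSpace ℝ V]
      (Z : V →L[ℝ] V), IsSemiNegative Z → ∀ v : V,
        energyBeta R (leadingIndex R) * ‖(Z ^ leadingIndex R) v‖ ^ 2 +
          ∑ i ∈ Finset.range (leadingIndex R), ∑ j ∈ Finset.range (leadingIndex R),
            energyGamma R i j * dissForm Z ((Z ^ i) v) ((Z ^ j) v) +
          (-(μ * dissForm Z ((Z ^ (leadingIndex R - 1)) v) ((Z ^ (leadingIndex R - 1)) v))
            + 2 * ν * ‖(Z ^ leadingIndex R) v‖ ^ 2) ≤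
        -(c * leadingNorm Z (leadingIndex R) v ^ 2) := by
  obtain ⟨c, hc, hcA⟩ := exists_pos_le_sum_mul_bilin.{u} hμ
  -- The first constant controls the dissipation terms, the second `‖Z ^ k* v‖²`; the latter is
  -- positive exactly because `ν < -β_{k*}/2`.
  refine ⟨min c (-(energyBeta R (leadingIndex R) + 2 * ν)), lt_min hc (by linarith),
    fun V _ _ Z hZ v => ?_⟩
  have h := hcA V (dissForm Z) (dissForm_self_nonneg hZ) fun i => (Z ^ (i : ℕ)) v
  have hsum : ∑ i : Fin (leadingIndex R), ∑ j : Fin (leadingIndex R),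
      (-(leadingMatrix R - lastDiag (leadingIndex R) μ)) i j *
        dissForm Z ((Z ^ (i : ℕ)) v) ((Z ^ (j : ℕ)) v) =
      -(∑ i ∈ Finset.range (leadingIndex R), ∑ j ∈ Finset.range (leadingIndex R),
          energyGamma R i j * dissForm Z ((Z ^ i) v) ((Z ^ j) v)) +
        μ * dissForm Z ((Z ^ (leadingIndex R - 1)) v) ((Z ^ (leadingIndex R - 1)) v) := by
    have hk := (leadingIndex_spec R hR.2).1
    have e1 : ∑ i : Fin (leadingIndex R), ∑ j : Fin (leadingIndex R),
        lastDiag (leadingIndex R) μ i j * dissForm Z ((Z ^ (i : ℕ)) v) ((Z ^ (j : ℕ)) v) =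
        μ * dissForm Z ((Z ^ (leadingIndex R - 1)) v) ((Z ^ (leadingIndex R - 1)) v) := by
      simp only [lastDiag, Matrix.diagonal_apply, ite_mul, zero_mul, Finset.sum_ite_eq,
        Finset.mem_univ, if_true]
      rw [Finset.sum_eq_single_of_mem (⟨leadingIndex R - 1, by omega⟩ : Fin (leadingIndex R))
        (Finset.mem_univ _)]
      · rw [if_pos (Nat.sub_add_cancel hk)]
      · intro i _ hi
        rw [if_neg fun h => hi (Fin.ext (by simp only; omega))]
    simp only [Matrix.neg_apply, Matrix.sub_apply, neg_sub, sub_mul, Finset.sum_sub_distrib, e1,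
      leadingMatrix, Matrix.of_apply, Finset.sum_range]
    ring
  rw [hsum, ← Finset.sum_range (fun i => dissForm Z ((Z ^ i) v) ((Z ^ i) v))] at h
  have h1 : 0 ≤ ∑ i ∈ Finset.range (leadingIndex R), dissForm Z ((Z ^ i) v) ((Z ^ i) v) :=
    Finset.sum_nonneg fun _ _ => dissForm_self_nonneg hZ _
  have h2 := mul_le_mul_of_nonneg_right
    (min_le_left c (-(energyBeta R (leadingIndex R) + 2 * ν))) h1
  have h3 := mul_le_mul_of_nonneg_right
    (min_le_right c (-(energyBeta R (leadingIndex R) + 2 * ν)))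
    (sq_nonneg ‖(Z ^ leadingIndex R) v‖)
  rw [leadingNorm_sq hZ]
  linarith

/-- A uniform bound for the increase of energy in a small step gives strong stability. -/
theorem isStronglyStable_of_energy_le {Φ : LinearMethod.{u}} {k : ℕ} {c K : ℝ} (hc : 0 < c)
    (hK : 0 ≤ K)
    (hΦ : ∀ (V : Type u) [NormedAddCommGroup V] [InnerProductSpace ℝ V] (Z Zt : V →L[ℝ] V)
      (s : ℝ), IsSmallStep Z Zt s → ∀ v : V,
        ‖Φ V Z Zt v‖ ^ 2 - ‖v‖ ^ 2 ≤
          -(c * leadingNorm Z k v ^ 2) + K * (s * leadingNorm Z k v ^ 2)) :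
    IsStronglyStable Φ := by
  -- This `s` satisfies `K s ≤ c`; `K + 1` avoids dividing by zero. The step size constant `s² / 2`
  -- then gives `2‖τ L‖ ≤ s²`.
  have hs0 : 0 < min 1 (c / (K + 1)) := lt_min one_pos (by positivity)
  refine ⟨min 1 (c / (K + 1)) ^ 2 / 2, by positivity, fun V _ _ L Lt hL hLt τ hτ hτL v => ?_⟩
  have hstep : IsSmallStep (τ • L) (τ • Lt) (min 1 (c / (K + 1))) :=
    ⟨hL.smul hτ.le, hLt.smul τ, hs0.le, min_le_left _ _, by linarith⟩
  have h := hΦ V _ _ _ hstep v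
  have h1 : K * min 1 (c / (K + 1)) ≤ c := by
    calc K * min 1 (c / (K + 1)) ≤ (K + 1) * (c / (K + 1)) :=
          mul_le_mul (by linarith) (min_le_right _ _) hs0.le (by linarith)
      _ = c := mul_div_cancel₀ c (by positivity)
  have h2 := mul_le_mul_of_nonneg_right h1 (sq_nonneg (leadingNorm (τ • L) k v))
  refine abs_le_of_sq_le_sq' ?_ (norm_nonneg v) |>.2
  nlinarith

theorem abs_norm_sq_sub_le {V : Type*} [NormedAddCommGroup V] {x y : V} {q s E : ℝ}
    (hs0 : 0 ≤ s) (hs1 : s ≤ 1) (hy : ‖y‖ ≤ q) (hx : ‖x - y‖ ≤ E * s * q) :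
    |‖x‖ ^ 2 - ‖y‖ ^ 2| ≤ (2 * E + E ^ 2) * s * q ^ 2 := by
  have h1 : |‖x‖ - ‖y‖| ≤ E * s * q := (abs_norm_sub_norm_le x y).trans hx
  have h2 : ‖x‖ + ‖y‖ ≤ 2 * q + E * s * q := by
    linarith [abs_le.1 h1 |>.2]
  have h3 : s ^ 2 * (E ^ 2 * q ^ 2) ≤ s * (E ^ 2 * q ^ 2) :=
    mul_le_mul_of_nonneg_right (by nlinarith) (by positivity)
  rw [show ‖x‖ ^ 2 - ‖y‖ ^ 2 = (‖x‖ - ‖y‖) * (‖x‖ + ‖y‖) by ring, abs_mul,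
    abs_of_nonneg (by positivity : 0 ≤ ‖x‖ + ‖y‖)]
  refine (mul_le_mul h1 h2 (by positivity) ((norm_nonneg _).trans hx)).trans ?_
  nlinarith

section

variable {V : Type u} [NormedAddCommGroup V] [InnerProductSpace ℝ V]

theorem IsSmallStep.norm_sq_aeval_sub_le {Z Zt : V →L[ℝ] V} {s : ℝ} (h : IsSmallStep Z Zt s)
    {R : ℝ[X]} (hR : IsConsistent R) (v : V) :
    ‖aeval Z R v‖ ^ 2 - ‖v‖ ^ 2 ≤
      energyBeta R (leadingIndex R) * ‖(Z ^ leadingIndex R) v‖ ^ 2 +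
        ∑ i ∈ Finset.range (leadingIndex R), ∑ j ∈ Finset.range (leadingIndex R),
          energyGamma R i j * dissForm Z ((Z ^ i) v) ((Z ^ j) v) +
        energySize R (R.natDegree + leadingIndex R) *
          (s * leadingNorm Z (leadingIndex R) v ^ 2) := by
  set k := leadingIndex R with hk
  set q := leadingNorm Z k v with hq
  have hq0 : 0 ≤ q := leadingNorm_nonneg Z k v
  have hs := h.nonneg
  have hs1 := h.le_one
  -- The length `R.natDegree + k` is at least the degree and at least `k`, as the identity and
  -- `energy_sum_le` require.
  rw [energy_identity R hR.1 (R.natDegree + k) (by omega) Z v]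
  have := energy_sum_le hR (n := R.natDegree + k) (by omega) (fun j => ‖(Z ^ j) v‖ ^ 2)
    (fun i j => dissForm Z ((Z ^ i) v) ((Z ^ j) v)) (fun i j => dissForm Z ((Z ^ i) v) ((Z ^ j) v))
    (‖(Z ^ k) v‖ ^ 2) 0 (s * q ^ 2) ?_ ?_
  · rw [sub_zero] at this
    exact this
  · intro j _ hkj
    split_ifs with hj
    · rw [hj, sub_self, abs_zero]
      positivity
    · obtain ⟨l, rfl⟩ := Nat.exists_eq_add_of_le hkj
      rw [sub_zero, abs_of_nonneg (by positivity)]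
      have h1 := h.norm_pow_add_le_mul k (j := l) (by omega) v
      calc ‖(Z ^ (k + l)) v‖ ^ 2 ≤ (s * q) ^ 2 := pow_le_pow_left₀ (norm_nonneg _) h1 2
        _ ≤ s * q ^ 2 := by nlinarith [sq_nonneg q, mul_nonneg hs (sq_nonneg q)]
  · intro i _ j _
    simp only [ite_self, add_zero]
    split_ifs with hij
    · rw [sub_self, abs_zero]
      positivity
    · rw [sub_zero]
      rcases not_and_or.1 hij with hi | hj
      · exact (abs_dissForm_le_of_le h.semiNegative (h.dissNorm_pow_le_mul (not_lt.1 hi) v)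
          (h.dissNorm_pow_le k j v)).trans_eq (by ring)
      · exact (abs_dissForm_le_of_le h.semiNegative (h.dissNorm_pow_le k i v)
          (h.dissNorm_pow_le_mul (not_lt.1 hj) v)).trans_eq (by ring)

end

/-! ### Strong stability of the filtering method. -/

section

variable {V : Type u} [NormedAddCommGroup V] [InnerProductSpace ℝ V]

/-- `∑_{j≥1} |α_j|`. -/
noncomputable def tailSize (R : ℝ[X]) : ℝ := ∑ j ∈ Finset.range R.natDegree, |R.coeff (j + 1)|

theorem tailSize_nonneg (R : ℝ[X]) : 0 ≤ tailSize R :=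
  Finset.sum_nonneg fun _ _ => abs_nonneg _

/-- Since `α₀ = 1`, the difference `R(Z)v - v` contains only positive powers of `Z`. -/
theorem norm_pow_aeval_sub_le {Z : V →L[ℝ] V} {R : ℝ[X]} (h0 : R.coeff 0 = 1) (m : ℕ) (v : V)
    {a : ℝ} (ha : ∀ j, ‖(Z ^ (m + (j + 1))) v‖ ≤ a) :
    ‖(Z ^ m) (aeval Z R v) - (Z ^ m) v‖ ≤ tailSize R * a := by
  have e : (Z ^ m) (aeval Z R v) - (Z ^ m) v =
      ∑ j ∈ Finset.range R.natDegree, R.coeff (j + 1) • (Z ^ (m + (j + 1))) v := by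
    rw [Polynomial.aeval_eq_sum_range, Finset.sum_range_succ', h0]
    simp only [_root_.add_apply, _root_.sum_apply, _root_.smul_apply, map_add, map_sum, map_smul,
      one_smul, pow_zero, one_apply_eq_self, add_sub_cancel_right]
    refine Finset.sum_congr rfl fun j _ => ?_
    rw [pow_add Z m, mul_apply_eq_comp]
  rw [e, tailSize, Finset.sum_mul]
  refine (norm_sum_le _ _).trans (Finset.sum_le_sum fun j _ => ?_)
  rw [norm_smul, Real.norm_eq_abs]
  exact mul_le_mul_of_nonneg_left (ha j) (abs_nonneg _)

end

/-- With `w = R(Z)v`, expand `‖w + Ww‖² = ‖w‖² + 2⟪Ww, w⟫ + ‖Ww‖²`. The last term is `O(s² q²)`, and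
in the middle one `w` may be replaced by `v` at the cost of `O(s q²)`. -/
theorem filteringMethod_isStronglyStable {R : ℝ[X]} (hR : IsConsistent R) {μ ν : ℝ}
    (hν : ν < -energyBeta R (leadingIndex R) / 2)
    (hμ : (-(leadingMatrix R - lastDiag (leadingIndex R) μ)).PosDef)
    (hkμ : 2 ≤ leadingIndex R ∨ μ = 0) :
    IsStronglyStable.{u} (filteringMethod R μ ν) := by
  obtain ⟨c, hc, hlead⟩ := exists_leading_part_le.{u} hR hν hμ
  have hk1 := (leadingIndex_spec R hR.2).1
  set k := leadingIndex R with hk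
  set a := tailSize R with ha
  have ha0 : 0 ≤ a := tailSize_nonneg R
  refine isStronglyStable_of_energy_le (k := k) (K := energySize R (R.natDegree + k) +
    (|μ| + 2 * |ν|) * (2 * a + a ^ 2) + (|μ| + |ν|) ^ 2 * (1 + a) ^ 2) hc
    (by have := energySize_nonneg R (R.natDegree + k); positivity) ?_
  intro V _ _ Z Zt s h v
  have hs := h.nonneg
  have hs1 := h.le_one
  set q := leadingNorm Z k v with hq
  have hq0 : 0 ≤ q := leadingNorm_nonneg Z k v
  set w := aeval Z R v with hw
  have hΦ : filteringMethod R μ ν V Z Zt v = w + superviscosity k μ ν Z Zt w := by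
    simp only [filteringMethod, mul_apply_eq_comp, _root_.add_apply, one_apply_eq_self]
    rfl
  have h1 := h.norm_sq_aeval_sub_le hR v
  have h2 : ‖(Z ^ k) w - (Z ^ k) v‖ ≤ a * s * q :=
    (norm_pow_aeval_sub_le hR.1 k v fun j => h.norm_pow_add_le_mul k (by omega) v).trans_eq
      (by ring)
  -- The difference starts with `Z ^ k v`, which is only bounded by `q`; the factor `s` comes from
  -- passing to `dissNorm`.
  have h3 : dissNorm Z ((Z ^ (k - 1)) w - (Z ^ (k - 1)) v) ≤ a * s * q := by
    refine (h.dissNorm_le_mul_of_norm_le (norm_pow_aeval_sub_le hR.1 (k - 1) v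
      (a := q) fun j => ?_)).trans_eq (by ring)
    rw [show k - 1 + (j + 1) = k + j by omega]
    exact h.norm_pow_add_le k j v
  have h4 := abs_norm_sq_sub_le hs hs1 (norm_pow_le_leadingNorm h.semiNegative k v) h2
  have h5 := abs_dissForm_sub_le h.semiNegative hs hs1 (h.dissNorm_pow_le k (k - 1) v)
    (h.dissNorm_pow_le k (k - 1) v) h3 h3
  have h6 : ‖superviscosity k μ ν Z Zt w‖ ^ 2 ≤ (|μ| + |ν|) ^ 2 * (1 + a) ^ 2 * (s * q ^ 2) := by
    have h7 : ‖(Z ^ k) w‖ ≤ (1 + a) * q := by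
      have h8 := norm_le_norm_add_norm_sub' ((Z ^ k) w) ((Z ^ k) v)
      have h9 := norm_pow_le_leadingNorm h.semiNegative k v
      have : a * s * q ≤ a * q := by nlinarith [mul_nonneg ha0 hq0]
      linarith
    have h8 := (h.norm_superviscosity_le hk1 hkμ ν w).trans
      (mul_le_mul_of_nonneg_left h7 (by positivity))
    refine (pow_le_pow_left₀ (norm_nonneg _) h8 2).trans ?_
    have : s ^ 2 * ((|μ| + |ν|) ^ 2 * (1 + a) ^ 2 * q ^ 2) ≤
        s * ((|μ| + |ν|) ^ 2 * (1 + a) ^ 2 * q ^ 2) :=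
      mul_le_mul_of_nonneg_right (by nlinarith) (by positivity)
    linarith
  have h7 := mul_le_mul_add_abs_mul (a := 2 * ν) h4
  have h8 := mul_le_mul_add_abs_mul (a := -μ) h5
  rw [abs_mul, abs_two] at h7
  rw [abs_neg] at h8
  have h9 := hlead V Z h.semiNegative v
  have h10 := two_mul_inner_superviscosity h.adjoint hk1 μ ν w
  rw [hΦ, norm_add_sq_real, real_inner_comm]
  linarith

/-! ### Strong stability of the modified method -/

section

variable {V : Type u} [NormedAddCommGroup V] [InnerProductSpace ℝ V]

/-- `W` starts with `Z ^ k`, so each error is measured by the leading norm instead of `‖v‖`. The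
constants satisfy `e_{j+1} = (1 + M) e_j + M`. -/
theorem IsSmallStep.norm_add_superviscosity_pow_sub_le {Z Zt : V →L[ℝ] V} {s : ℝ}
    (h : IsSmallStep Z Zt s) {k : ℕ} (hk : 1 ≤ k) {μ : ℝ} (hkμ : 2 ≤ k ∨ μ = 0) (ν : ℝ) (v : V)
    (j : ℕ) : ‖((Z + superviscosity k μ ν Z Zt) ^ j) v - (Z ^ j) v‖ ≤
      ((1 + (|μ| + |ν|)) ^ j - 1) * s * leadingNorm Z k v := by
  set M := |μ| + |ν| with hM
  have hM0 : 0 ≤ M := by positivity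
  set W := superviscosity k μ ν Z Zt with hW
  have hs := h.nonneg
  have hs1 := h.le_one
  have hq0 : 0 ≤ leadingNorm Z k v := leadingNorm_nonneg Z k v
  have hbound : ∀ x, ‖(Z + W) x‖ ≤ (1 + M) * ‖x‖ := fun x => by
    have h1 : ‖Z x‖ ≤ ‖x‖ := by simpa using h.norm_pow_le 1 x
    have h2 : M * s * ‖(Z ^ k) x‖ ≤ M * ‖x‖ :=
      mul_le_mul (by nlinarith) (h.norm_pow_le k x) (norm_nonneg _) hM0
    have h3 := h.norm_superviscosity_le hk hkμ ν x
    rw [_root_.add_apply]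
    refine (norm_add_le _ _).trans ?_
    linarith
  induction j with
  | zero => simp
  | succ j ih =>
    have e : ((Z + W) ^ (j + 1)) v - (Z ^ (j + 1)) v =
        (Z + W) (((Z + W) ^ j) v - (Z ^ j) v) + W ((Z ^ j) v) := by
      simp only [pow_succ', mul_apply_eq_comp, map_sub, _root_.add_apply]
      abel
    have h1 : ‖W ((Z ^ j) v)‖ ≤ M * s * leadingNorm Z k v := by
      refine (h.norm_superviscosity_le hk hkμ ν _).trans
        (mul_le_mul_of_nonneg_left ?_ (by positivity))
      rw [← mul_apply_eq_comp, ← pow_add]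
      exact h.norm_pow_add_le k j v
    rw [e]
    refine (norm_add_le _ _).trans ((add_le_add ((hbound _).trans
      (mul_le_mul_of_nonneg_left ih (by positivity))) h1).trans_eq ?_)
    ring

end

/-- Apply the energy identity to `Z + W`. Its powers `x j` of `v` are `O(s q)`-close to `Z ^ j v`,
and the additional part `D` of its form matters only at `i = j = 0`. -/
theorem modifiedMethod_isStronglyStable {R : ℝ[X]} (hR : IsConsistent R) {μ ν : ℝ}
    (hν : ν < -energyBeta R (leadingIndex R) / 2)
    (hμ : (-(leadingMatrix R - lastDiag (leadingIndex R) μ)).PosDef)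
    (hkμ : 2 ≤ leadingIndex R ∨ μ = 0) :
    IsStronglyStable.{u} (modifiedMethod R μ ν) := by
  obtain ⟨c, hc, hlead⟩ := exists_leading_part_le.{u} hR hν hμ
  have hk1 := (leadingIndex_spec R hR.2).1
  set k := leadingIndex R with hk
  set n := R.natDegree + k with hn
  set E := (1 + (|μ| + |ν|)) ^ n with hE
  have hE0 : 0 ≤ E := by positivity
  refine isStronglyStable_of_energy_le (k := k)
    (K := energySize R n * ((1 + |μ| + 2 * |ν|) * (1 + E) ^ 2)) hc
    (by have := energySize_nonneg R n; positivity) ?_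
  intro V _ _ Z Zt s h v
  have hs := h.nonneg
  have hs1 := h.le_one
  set q := leadingNorm Z k v with hq
  have hq0 : 0 ≤ q := leadingNorm_nonneg Z k v
  have hsq : 0 ≤ s * q ^ 2 := by positivity
  set x : ℕ → V := fun j => ((Z + superviscosity k μ ν Z Zt) ^ j) v with hx
  have he : ∀ j ≤ n, ‖x j - (Z ^ j) v‖ ≤ E * s * q := fun j hj => by
    refine (h.norm_add_superviscosity_pow_sub_le hk1 hkμ ν v j).trans ?_
    have : (1 + (|μ| + |ν|)) ^ j - 1 ≤ E :=
      (sub_le_self _ zero_le_one).trans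
        (pow_le_pow_right₀ (by linarith [abs_nonneg μ, abs_nonneg ν]) hj)
    exact mul_le_mul_of_nonneg_right (mul_le_mul_of_nonneg_right this hs) hq0
  have hEs : E * s * q ≤ E * q := by nlinarith [mul_nonneg hE0 hq0]
  have hpow : ∀ m j, (Z ^ m) ((Z ^ j) v) = (Z ^ (m + j)) v := fun m j => by
    rw [pow_add, mul_apply_eq_comp]
  have hdiss : ∀ j ≤ n, dissNorm Z (x j - (Z ^ j) v) ≤ E * s * q := fun j hj =>
    ((h.dissNorm_le_mul_of_norm_le (he j hj)).trans_eq (by ring)).trans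
      (mul_le_of_le_one_left (by positivity : 0 ≤ E * s * q) hs1)
  have hsmall : ∀ j ≤ n, ∀ m, 1 ≤ j → k ≤ m + j →
      ‖(Z ^ m) (x j)‖ ≤ (1 + E) * q := fun j hj m _ hm => by
    have h1 := norm_le_norm_add_norm_sub' ((Z ^ m) (x j)) ((Z ^ m) ((Z ^ j) v))
    have h2 := (h.norm_pow_le m (x j - (Z ^ j) v)).trans ((he j hj).trans hEs)
    obtain ⟨l, hl⟩ := Nat.exists_eq_add_of_le hm
    have h3 := h.norm_pow_add_le k l v
    rw [← map_sub] at h1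
    rw [hpow m j, hl] at h1
    linarith
  have hsmall' : ∀ j ≤ n, ∀ m, k < m + j →
      ‖(Z ^ m) (x j)‖ ≤ (1 + E) * s * q := fun j hj m hm => by
    have h1 := norm_le_norm_add_norm_sub' ((Z ^ m) (x j)) ((Z ^ m) ((Z ^ j) v))
    have h2 := (h.norm_pow_le m (x j - (Z ^ j) v)).trans (he j hj)
    obtain ⟨l, hl⟩ := Nat.exists_eq_add_of_le hm.le
    have h3 := h.norm_pow_add_le_mul k (j := l) (by omega) v
    rw [← map_sub] at h1
    rw [hpow m j, hl] at h1
    linarith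
  have hx0 : x 0 = v := by simp [hx]
  have hb : ∀ j ≤ n, j ≠ 0 → dissNorm Z ((Z ^ (k - 1)) (x j)) ≤ (1 + E) * s * q :=
    fun j hj hj0 => (h.dissNorm_le_mul_of_norm_le
      (hsmall j hj (k - 1) (by omega) (by omega))).trans_eq (by ring)
  have hb' : ∀ j ≤ n, dissNorm Z ((Z ^ (k - 1)) (x j)) ≤ (1 + E) * q := fun j hj => by
    rcases eq_or_ne j 0 with rfl | hj0
    · rw [hx0]
      exact (h.dissNorm_pow_le k (k - 1) v).trans (by nlinarith [mul_nonneg hE0 hq0])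
    · exact (hb j hj hj0).trans (by nlinarith [mul_nonneg hE0 hq0])
  have hc1 : ∀ j ≤ n, j ≠ 0 → ‖(Z ^ k) (x j)‖ ≤ (1 + E) * s * q :=
    fun j hj hj0 => hsmall' j hj k (by omega)
  have hc2 : ∀ j ≤ n, ‖(Z ^ k) (x j)‖ ≤ (1 + E) * q := fun j hj => by
    rcases eq_or_ne j 0 with rfl | hj0
    · rw [hx0]
      exact (norm_pow_le_leadingNorm h.semiNegative k v).trans
        (by nlinarith [mul_nonneg hE0 hq0])
    · exact (hc1 j hj hj0).trans (by nlinarith [mul_nonneg hE0 hq0])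
  set D : V → V → ℝ := fun y z => μ * dissForm Z ((Z ^ (k - 1)) y) ((Z ^ (k - 1)) z)
        - 2 * ν * ⟪(Z ^ k) y, (Z ^ k) z⟫_ℝ with hD
  -- If one index is positive, the corresponding argument carries an additional factor `Z` up to a
  -- small error, and this yields the factor `s`.
  have hDle : ∀ i ≤ n, ∀ j ≤ n, ¬ (i = 0 ∧ j = 0) →
      |D (x i) (x j)| ≤ (|μ| + 2 * |ν|) * (1 + E) ^ 2 * (s * q ^ 2) := fun i hi j hj hij => by
    have h1 : |dissForm Z ((Z ^ (k - 1)) (x i)) ((Z ^ (k - 1)) (x j))| ≤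
        (1 + E) ^ 2 * (s * q ^ 2) := by
      by_cases hi0 : i = 0
      · exact (abs_dissForm_le_of_le h.semiNegative (hb' i hi)
          (hb j hj fun hj0 => hij ⟨hi0, hj0⟩)).trans_eq (by ring)
      · exact (abs_dissForm_le_of_le h.semiNegative (hb i hi hi0) (hb' j hj)).trans_eq (by ring)
    have h2 : |⟪(Z ^ k) (x i), (Z ^ k) (x j)⟫_ℝ| ≤ (1 + E) ^ 2 * (s * q ^ 2) := by
      refine (abs_real_inner_le_norm _ _).trans ?_
      by_cases hi0 : i = 0
      · exact (mul_le_mul (hc2 i hi) (hc1 j hj fun hj0 => hij ⟨hi0, hj0⟩) (norm_nonneg _)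
          (by positivity)).trans_eq (by ring)
      · exact (mul_le_mul (hc1 i hi hi0) (hc2 j hj) (norm_nonneg _)
          (by positivity)).trans_eq (by ring)
    refine (abs_sub _ _).trans ?_
    rw [abs_mul, abs_mul, abs_mul, abs_two]
    have h3 := mul_le_mul_of_nonneg_left h1 (abs_nonneg μ)
    have h4 := mul_le_mul_of_nonneg_left h2 (by positivity : 0 ≤ 2 * |ν|)
    linarith
  have hform : ∀ i ≤ n, ∀ j ≤ n, |dissForm Z (x i) (x j) -
      if i < k ∧ j < k then dissForm Z ((Z ^ i) v) ((Z ^ j) v) else 0| ≤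
        (1 + E) ^ 2 * (s * q ^ 2) := fun i hi j hj => by
    have h1 := abs_dissForm_sub_le h.semiNegative hs hs1 (h.dissNorm_pow_le k i v)
      (h.dissNorm_pow_le k j v) (hdiss i hi) (hdiss j hj)
    split_ifs with hij
    · linarith
    · have h2 : |dissForm Z ((Z ^ i) v) ((Z ^ j) v)| ≤ s * q ^ 2 := by
        rcases not_and_or.1 hij with hi | hj
        · exact (abs_dissForm_le_of_le h.semiNegative (h.dissNorm_pow_le_mul (not_lt.1 hi) v)
            (h.dissNorm_pow_le k j v)).trans_eq (by ring)
        · exact (abs_dissForm_le_of_le h.semiNegative (h.dissNorm_pow_le k i v)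
            (h.dissNorm_pow_le_mul (not_lt.1 hj) v)).trans_eq (by ring)
      rw [sub_zero]
      have h3 := abs_sub_abs_le_abs_sub (dissForm Z (x i) (x j))
        (dissForm Z ((Z ^ i) v) ((Z ^ j) v))
      linarith
  have hΦ : modifiedMethod R μ ν V Z Zt v = aeval (Z + superviscosity k μ ν Z Zt) R v := rfl
  rw [hΦ, energy_identity R hR.1 n (by omega) (Z + superviscosity k μ ν Z Zt) v]
  have hmain := energy_sum_le hR (n := n) (by omega) (fun j => ‖x j‖ ^ 2)
    (fun i j => dissForm (Z + superviscosity k μ ν Z Zt) (x i) (x j))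
    (fun i j => dissForm Z ((Z ^ i) v) ((Z ^ j) v))
    (‖(Z ^ k) v‖ ^ 2) (D v v) ((1 + |μ| + 2 * |ν|) * (1 + E) ^ 2 * (s * q ^ 2)) ?_ ?_
  · refine hmain.trans ?_
    have h9 := hlead V Z h.semiNegative v
    have hDv : D v v = μ * dissForm Z ((Z ^ (k - 1)) v) ((Z ^ (k - 1)) v)
        - 2 * ν * ‖(Z ^ k) v‖ ^ 2 := by
      rw [← real_inner_self_eq_norm_sq]
    rw [hDv]
    linarith
  · intro j hj hkj
    have hpos : 0 ≤ (|μ| + 2 * |ν|) * (1 + E) ^ 2 * (s * q ^ 2) := by positivity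
    split_ifs with hjk
    · have h1 := abs_norm_sq_sub_le hs hs1 (norm_pow_le_leadingNorm h.semiNegative k v)
        (hjk ▸ he j hj)
      have h2 : (2 * E + E ^ 2) * s * q ^ 2 ≤ (1 + E) ^ 2 * (s * q ^ 2) := by linarith
      rw [hjk]
      linarith
    · rw [sub_zero, abs_of_nonneg (by positivity)]
      have h1 := hsmall' j hj 0 (by omega)
      rw [pow_zero, one_apply_eq_self] at h1
      have h2 : s ^ 2 * ((1 + E) ^ 2 * q ^ 2) ≤ s * ((1 + E) ^ 2 * q ^ 2) :=
        mul_le_mul_of_nonneg_right (by nlinarith) (by positivity)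
      refine (pow_le_pow_left₀ (norm_nonneg _) h1 2).trans ?_
      linarith
  · intro i hi j hj
    have h1 := hform i hi.le j hj.le
    rw [dissForm_add_superviscosity h.adjoint hk1]
    change |dissForm Z (x i) (x j) + D (x i) (x j) - _| ≤ _
    split_ifs with h2 h3
    · rw [if_pos h2] at h1
      obtain ⟨rfl, rfl⟩ := h3
      rw [hx0, add_sub_add_right_eq_sub]
      rw [hx0] at h1
      have : 0 ≤ (|μ| + 2 * |ν|) * (1 + E) ^ 2 * (s * q ^ 2) := by positivity
      linarith
    · rw [if_pos h2] at h1
      have h4 := hDle i hi.le j hj.le h3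
      rw [add_zero, add_sub_right_comm]
      refine (abs_add_le _ _).trans ?_
      linarith
    -- The pair `(0, 0)` lies in the leading block because `k ≥ 1`.
    · omega
    · rw [if_neg h2, sub_zero] at h1
      have h4 := hDle i hi.le j hj.le ‹_›
      rw [add_zero, sub_zero]
      refine (abs_add_le _ _).trans ?_
      linarith

/-! ### Taylor expansion of solutions -/

section Solution

variable {V : Type u} [NormedAddCommGroup V] [InnerProductSpace ℝ V]

theorem IsSolution.norm_le {L : V →L[ℝ] V} (hL : IsSemiNegative L) {x : ℝ → V}
    (hx : IsSolution L x) {t : ℝ} (ht : 0 ≤ t) : ‖x t‖ ≤ ‖x 0‖ := by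
  have hanti : AntitoneOn (fun t => ‖x t‖ ^ 2) (Set.Ici 0) := by
    refine antitoneOn_of_hasDerivWithinAt_nonpos (f' := fun t => 2 * ⟪x t, L (x t)⟫_ℝ)
      (convex_Ici 0) (fun t ht => ?_) (fun t ht => ?_) (fun t ht => ?_)
    · exact ((hx t ht).norm_sq).continuousWithinAt
    · exact ((hx t (interior_subset ht)).norm_sq).mono interior_subset
    · have := hL (x t)
      rw [real_inner_comm] at this
      linarith
  exact abs_le_of_sq_le_sq' (hanti Set.self_mem_Ici ht ht) (norm_nonneg _) |>.2

theorem hasDerivAt_taylor_sum (L : V →L[ℝ] V) (v : V) (n : ℕ) (t : ℝ) :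
    HasDerivAt (fun t : ℝ => ∑ j ∈ Finset.range (n + 1), (t ^ j / (j.factorial : ℝ)) • (L ^ j) v)
      (L (∑ j ∈ Finset.range n, (t ^ j / (j.factorial : ℝ)) • (L ^ j) v)) t := by
  have h1 : HasDerivAt (fun t : ℝ => ∑ j ∈ Finset.range n,
      (t ^ (j + 1) / ((j + 1).factorial : ℝ)) • (L ^ (j + 1)) v + v)
      (∑ j ∈ Finset.range n, (t ^ j / (j.factorial : ℝ)) • (L ^ (j + 1)) v) t := by
    refine (HasDerivAt.fun_sum fun j _ => ?_).add_const v
    refine HasDerivAt.smul_const ?_ _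
    have := (hasDerivAt_pow (j + 1) t).div_const ((j + 1).factorial : ℝ)
    convert this using 1
    rw [Nat.factorial_succ, Nat.add_sub_cancel]
    have h1 : (j.factorial : ℝ) ≠ 0 := by positivity
    push_cast
    field_simp
  convert h1 using 1
  · funext t
    simp [Finset.sum_range_succ' _ n]
  · simp only [map_sum, map_smul, pow_succ', mul_apply_eq_comp]

/-- The derivative of each Taylor remainder is `L` applied to the previous one, so the bounds
integrate inductively. Arguing with the solution avoids `e^{tL}`, whose series need not converge in
an incomplete space. -/
theorem IsSolution.norm_sub_taylor_le {L : V →L[ℝ] V} (hL : IsSemiNegative L) {x : ℝ → V}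
    (hx : IsSolution L x) (n : ℕ) {t : ℝ} (ht : 0 ≤ t) :
    ‖x t - ∑ j ∈ Finset.range n, (t ^ j / (j.factorial : ℝ)) • (L ^ j) (x 0)‖ ≤
      ‖L‖ ^ n * ‖x 0‖ * (t ^ n / (n.factorial : ℝ)) := by
  induction n generalizing t with
  | zero => simpa using hx.norm_le hL ht
  | succ n ih =>
    have hderiv : ∀ r, 0 ≤ r → HasDerivWithinAt (fun r => x r -
        ∑ j ∈ Finset.range (n + 1), (r ^ j / (j.factorial : ℝ)) • (L ^ j) (x 0))
        (L (x r - ∑ j ∈ Finset.range n, (r ^ j / (j.factorial : ℝ)) • (L ^ j) (x 0)))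
        (Set.Ici 0) r := fun r hr => by
      rw [map_sub]
      exact (hx r hr).sub (hasDerivAt_taylor_sum L (x 0) n r).hasDerivWithinAt
    refine image_norm_le_of_norm_deriv_right_le_deriv_boundary (a := 0) (b := t)
      (B := fun r => ‖L‖ ^ (n + 1) * ‖x 0‖ * (r ^ (n + 1) / ((n + 1).factorial : ℝ)))
      (B' := fun r => ‖L‖ ^ (n + 1) * ‖x 0‖ * (r ^ n / (n.factorial : ℝ)))
      (fun r hr => ((hderiv r hr.1).continuousWithinAt).mono Set.Icc_subset_Ici_self)
      (fun r hr => (hderiv r hr.1).mono (Set.Ici_subset_Ici.2 hr.1)) ?_ (fun r => ?_)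
      (fun r hr => ?_) ⟨ht, le_rfl⟩
    · simp [Finset.sum_range_succ']
    · refine HasDerivAt.const_mul _ ?_
      have := (hasDerivAt_pow (n + 1) r).div_const ((n + 1).factorial : ℝ)
      convert this using 1
      rw [Nat.factorial_succ, Nat.add_sub_cancel]
      have h1 : (n.factorial : ℝ) ≠ 0 := by positivity
      push_cast
      field_simp
    · refine (L.le_opNorm _).trans ((mul_le_mul_of_nonneg_left (ih hr.1)
        (norm_nonneg _)).trans_eq ?_)
      ring

end Solution

/-! ### Expansion of the methods -/

open Asymptotics Filter Topology

section Expansion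

variable {A : Type*} [NormedRing A] [NormedAlgebra ℝ A]

theorem isBigO_pow_of_le {m n : ℕ} (h : m ≤ n) :
    (fun τ : ℝ => τ ^ n) =O[𝓝[>] 0] fun τ => τ ^ m :=
  (IsBigO.of_bound 1 (by
    filter_upwards [Ioo_mem_nhdsGT (zero_lt_one' ℝ)] with τ hτ
    rw [one_mul, norm_pow, norm_pow, Real.norm_eq_abs, abs_of_pos hτ.1]
    exact pow_le_pow_of_le_one hτ.1.le hτ.2.le h))

theorem isBigO_mul_pow_smul {m n : ℕ} (h : m ≤ n) (c : ℝ) (a : A) :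
    (fun τ : ℝ => (c * τ ^ n) • a) =O[𝓝[>] 0] fun τ => τ ^ m := by
  have h1 := (isBigO_refl (fun τ : ℝ => c * τ ^ n) (𝓝[>] 0)).smul
    (isBigO_const_const a (one_ne_zero (α := ℝ)) (𝓝[>] 0))
  simp only [smul_eq_mul, mul_one] at h1
  exact h1.trans ((isBigO_const_mul_self c _ _).trans (isBigO_pow_of_le h))

theorem aeval_smul_eq_sum (R : ℝ[X]) {n : ℕ} (hn : R.natDegree < n) (τ : ℝ) (a : A) :
    aeval (τ • a) R = ∑ j ∈ Finset.range n, (R.coeff j * τ ^ j) • a ^ j := by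
  rw [Polynomial.aeval_eq_sum_range' hn]
  simp only [_root_.smul_pow, smul_smul]

theorem aeval_smul_sub_taylor_isBigO {R : ℝ[X]} {p : ℕ}
    (hp : ∀ k ≤ p, R.coeff k = 1 / (k.factorial : ℝ)) (a : A) :
    (fun τ : ℝ => aeval (τ • a) R - ∑ j ∈ Finset.range (p + 2), (τ ^ j / (j.factorial : ℝ)) • a ^ j
      - τ ^ (p + 1) • ((R.coeff (p + 1) - 1 / ((p + 1).factorial : ℝ)) • a ^ (p + 1)))
      =O[𝓝[>] 0] fun τ => τ ^ (p + 2) := by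
  have e : ∀ τ : ℝ, aeval (τ • a) R -
      ∑ j ∈ Finset.range (p + 2), (τ ^ j / (j.factorial : ℝ)) • a ^ j
      - τ ^ (p + 1) • ((R.coeff (p + 1) - 1 / ((p + 1).factorial : ℝ)) • a ^ (p + 1)) =
      ∑ i ∈ Finset.range (R.natDegree + 1),
        (R.coeff (p + 2 + i) * τ ^ (p + 2 + i)) • a ^ (p + 2 + i) := fun τ => by
    rw [aeval_smul_eq_sum R (n := p + 2 + (R.natDegree + 1)) (by omega), Finset.sum_range_add,
      Finset.sum_range_succ, Finset.sum_range_succ (n := p + 1)]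
    rw [Finset.sum_congr rfl fun j hj => by
      rw [hp j (Nat.lt_succ_iff.1 (Finset.mem_range.1 hj)), one_div_mul_eq_div]]
    module
  simp only [e]
  exact IsBigO.fun_sum fun i _ => isBigO_mul_pow_smul (by omega) _ _

theorem aeval_smul_sub_one_isBigO {R : ℝ[X]} (h0 : R.coeff 0 = 1) (a : A) :
    (fun τ : ℝ => aeval (τ • a) R - 1) =O[𝓝[>] 0] fun τ => τ ^ 1 := by
  have e : ∀ τ : ℝ, aeval (τ • a) R - 1 =
      ∑ j ∈ Finset.range R.natDegree, (R.coeff (j + 1) * τ ^ (j + 1)) • a ^ (j + 1) := fun τ => by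
    rw [aeval_smul_eq_sum R (Nat.lt_succ_self _), Finset.sum_range_succ', h0]
    simp
  simp only [e]
  exact IsBigO.fun_sum fun i _ => isBigO_mul_pow_smul (by omega) _ _

/-- For `j ≥ 2` each product containing `W` has a further factor of size `O(τ)`, so `W` counts only
for `j = 1`. -/
theorem add_pow_sub_pow_isBigO {p : ℕ} (hp : 1 ≤ p) (a : A) {W : ℝ → A}
    (hW : W =O[𝓝[>] 0] fun τ => τ ^ (p + 1)) (j : ℕ) :
    (fun τ : ℝ => (τ • a + W τ) ^ j - (τ • a) ^ j - if j = 1 then W τ else 0)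
      =O[𝓝[>] 0] fun τ => τ ^ (p + 2) := by
  have hZ : (fun τ : ℝ => τ • a) =O[𝓝[>] 0] fun τ => τ ^ 1 := by
    simpa using isBigO_mul_pow_smul (le_refl 1) 1 a
  have hZW : (fun τ : ℝ => τ • a + W τ) =O[𝓝[>] 0] fun τ => τ ^ 1 :=
    hZ.add (hW.trans (isBigO_pow_of_le (by omega)))
  have e : ∀ j (τ : ℝ), (τ • a + W τ) ^ (j + 1) - (τ • a) ^ (j + 1) =
      (τ • a + W τ) * ((τ • a + W τ) ^ j - (τ • a) ^ j) + W τ * (τ • a) ^ j := fun j τ => by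
    rw [pow_succ', pow_succ' (τ • a)]
    noncomm_ring
  have hone : ∀ b : ℝ → A, b =O[𝓝[>] 0] (fun τ : ℝ => τ ^ 1) →
      ∀ j, (fun τ => b τ ^ j) =O[𝓝[>] 0] fun τ : ℝ => τ ^ j := fun b hb j => by
    induction j with
    | zero => simpa using isBigO_const_const (1 : A) (one_ne_zero (α := ℝ)) _
    | succ j ih =>
      have := ih.mul hb
      simpa only [← pow_succ, ← pow_add] using this
  have hdiff : ∀ j, (fun τ : ℝ => (τ • a + W τ) ^ j - (τ • a) ^ j)
      =O[𝓝[>] 0] fun τ => τ ^ (p + 1) := fun j => by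
    induction j with
    | zero => simpa using isBigO_zero _ _
    | succ j ih =>
      simp only [e]
      refine IsBigO.add ?_ ?_
      · have := hZW.mul ih
        simp only [← pow_add] at this
        exact this.trans (isBigO_pow_of_le (by omega))
      · have := hW.mul (hone _ hZ j)
        simp only [← pow_add] at this
        exact this.trans (isBigO_pow_of_le (by omega))
  rcases j with _ | _ | j
  · simpa using isBigO_zero _ _
  · simpa using isBigO_zero _ _
  · simp only [e (j + 1), if_neg (show ¬ j + 1 + 1 = 1 by omega), sub_zero]
    refine IsBigO.add ?_ ?_
    · have := hZW.mul (hdiff (j + 1))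
      simp only [← pow_add] at this
      exact this.trans (isBigO_pow_of_le (by omega))
    · have := hW.mul (hone _ hZ (j + 1))
      simp only [← pow_add] at this
      exact this.trans (isBigO_pow_of_le (by omega))

theorem aeval_add_sub_aeval_isBigO {R : ℝ[X]} (h1 : R.coeff 1 = 1) {p : ℕ} (hp : 1 ≤ p) (a : A)
    {W : ℝ → A} (hW : W =O[𝓝[>] 0] fun τ => τ ^ (p + 1)) :
    (fun τ : ℝ => aeval (τ • a + W τ) R - aeval (τ • a) R - W τ)
      =O[𝓝[>] 0] fun τ => τ ^ (p + 2) := by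
  have e : ∀ τ : ℝ, aeval (τ • a + W τ) R - aeval (τ • a) R - W τ =
      ∑ j ∈ Finset.range (R.natDegree + 2),
        R.coeff j • ((τ • a + W τ) ^ j - (τ • a) ^ j - if j = 1 then W τ else 0) := fun τ => by
    rw [Polynomial.aeval_eq_sum_range' (n := R.natDegree + 2) (by omega),
      Polynomial.aeval_eq_sum_range' (n := R.natDegree + 2) (by omega)]
    simp only [smul_sub, Finset.sum_sub_distrib, smul_ite, smul_zero, Finset.sum_ite_eq',
      Finset.mem_range, h1, one_smul]
    rw [if_pos (by omega)]
  simp only [e]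
  exact IsBigO.fun_sum fun j _ => (add_pow_sub_pow_isBigO hp a hW j).const_smul_left (R.coeff j)

end Expansion


/-- The method `Φ` has the Taylor expansion of the exponential function up to order `p`, and
`c L^{p+1} + D(L, Lᵀ)` is the coefficient of `τ^{p+1}` in its truncation error. -/
def HasTruncationError (Φ D : LinearMethod.{u}) (p : ℕ) (c : ℝ) : Prop :=
  ∀ (V : Type u) [NormedAddCommGroup V] [InnerProductSpace ℝ V] (L Lt : V →L[ℝ] V),
    (fun τ : ℝ => Φ V (τ • L) (τ • Lt)
      - ∑ j ∈ Finset.range (p + 2), (τ ^ j / (j.factorial : ℝ)) • L ^ j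
      - τ ^ (p + 1) • (c • L ^ (p + 1) + D V L Lt)) =O[𝓝[>] 0] fun τ => τ ^ (p + 2)

theorem HasTruncationError.hasLinearOrderAtLeast {Φ D : LinearMethod.{u}} {p : ℕ} {c : ℝ}
    (h : HasTruncationError Φ D p c) : HasLinearOrderAtLeast Φ p := by
  intro V _ _ L Lt hL _
  have h1 : (fun τ : ℝ => Φ V (τ • L) (τ • Lt)
      - ∑ j ∈ Finset.range (p + 2), (τ ^ j / (j.factorial : ℝ)) • L ^ j)
      =O[𝓝[>] 0] fun τ => τ ^ (p + 1) := by
    have h2 := isBigO_mul_pow_smul (le_refl (p + 1)) 1 (c • L ^ (p + 1) + D V L Lt)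
    have h3 := ((h V L Lt).trans (isBigO_pow_of_le (by omega : p + 1 ≤ p + 2))).add h2
    simpa only [one_mul, sub_add_cancel] using h3
  obtain ⟨C, hC⟩ := h1.bound
  obtain ⟨δ, hδ, hδC⟩ := mem_nhdsGT_iff_exists_Ioc_subset.1 hC
  refine ⟨C + ‖L‖ ^ (p + 2), min δ 1, lt_min hδ one_pos, fun x hx τ hτ hτδ => ?_⟩
  have h2 := hδC ⟨hτ, hτδ.trans (min_le_left _ _)⟩
  have hτ1 : τ ≤ 1 := hτδ.trans (min_le_right _ _)
  simp only [Set.mem_ofPred_eq, norm_pow, Real.norm_eq_abs, abs_of_pos hτ] at h2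
  have h3 := ContinuousLinearMap.le_of_opNorm_le _ h2 (x 0)
  have h4 := hx.norm_sub_taylor_le hL (p + 2) hτ.le
  have h5 : τ ^ (p + 2) / ((p + 2).factorial : ℝ) ≤ τ ^ (p + 1) :=
    (div_le_self (by positivity) (Nat.one_le_cast.2 (Nat.factorial_pos _))).trans
      (pow_le_pow_of_le_one hτ.le hτ1 (by omega))
  have h6 := mul_le_mul_of_nonneg_left h5 (by positivity : 0 ≤ ‖L‖ ^ (p + 2) * ‖x 0‖)
  simp only [_root_.sub_apply, _root_.sum_apply, _root_.smul_apply] at h3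
  have h7 := norm_sub_le_norm_sub_add_norm_sub (Φ V (τ • L) (τ • Lt) (x 0))
    (∑ j ∈ Finset.range (p + 2), (τ ^ j / (j.factorial : ℝ)) • (L ^ j) (x 0)) (x τ)
  rw [norm_sub_rev] at h4
  linarith

theorem eq_zero_of_pow_smul_isBigO {V : Type*} [NormedAddCommGroup V] [NormedSpace ℝ V] {n : ℕ}
    {y : V} (h : (fun τ : ℝ => τ ^ n • y) =O[𝓝[>] 0] fun τ => τ ^ (n + 1)) : y = 0 := by
  obtain ⟨C, hC⟩ := h.bound
  have h1 : ∀ᶠ τ : ℝ in 𝓝[>] 0, ‖y‖ ≤ C * τ := by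
    filter_upwards [hC, self_mem_nhdsWithin] with τ hτ hτ0
    have hpos : 0 < τ := hτ0
    rw [norm_smul, norm_pow, norm_pow, Real.norm_eq_abs, abs_of_pos hpos, pow_succ] at hτ
    exact le_of_mul_le_mul_left (by linarith) (pow_pos hpos n)
  have h2 : Tendsto (fun τ : ℝ => C * τ) (𝓝[>] 0) (𝓝 0) :=
    ((continuous_const.mul continuous_id).tendsto' 0 0 (by simp)).mono_left nhdsWithin_le_nhds
  exact norm_le_zero_iff.1 (ge_of_tendsto h2 h1)

/-- Order `p + 1` leaves no room for a `τ^{p+1}` term along a solution: comparing with its Taylor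
polynomial isolates that coefficient. -/
theorem HasTruncationError.apply_eq_zero {Φ D : LinearMethod.{u}} {p : ℕ} {c : ℝ}
    (h : HasTruncationError Φ D p c) (hΦ : HasLinearOrderAtLeast Φ (p + 1)) {V : Type u}
    [NormedAddCommGroup V] [InnerProductSpace ℝ V] {L Lt : V →L[ℝ] V} (hL : IsSemiNegative L)
    (hLt : IsAdjointOf Lt L) {x : ℝ → V} (hx : IsSolution L x) :
    (c • L ^ (p + 1) + D V L Lt) (x 0) = 0 := by
  obtain ⟨C, τ₀, hτ₀, hC⟩ := hΦ V L Lt hL hLt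
  have h1 : (fun τ : ℝ => Φ V (τ • L) (τ • Lt) (x 0) - x τ)
      =O[𝓝[>] 0] fun τ => τ ^ (p + 2) := by
    refine IsBigO.of_bound (C * ‖x 0‖) ?_
    filter_upwards [Ioc_mem_nhdsGT hτ₀] with τ hτ
    rw [norm_pow, Real.norm_eq_abs, abs_of_pos hτ.1]
    exact (hC x hx τ hτ.1 hτ.2).trans_eq (by ring)
  have h2 : (fun τ : ℝ => x τ -
      ∑ j ∈ Finset.range (p + 2), (τ ^ j / (j.factorial : ℝ)) • (L ^ j) (x 0))
      =O[𝓝[>] 0] fun τ => τ ^ (p + 2) := by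
    refine IsBigO.of_bound (‖L‖ ^ (p + 2) * ‖x 0‖ / ((p + 2).factorial : ℝ)) ?_
    filter_upwards [self_mem_nhdsWithin] with τ hτ
    have hpos : 0 < τ := hτ
    rw [norm_pow, Real.norm_eq_abs, abs_of_pos hpos]
    exact (hx.norm_sub_taylor_le hL (p + 2) hpos.le).trans_eq (by ring)
  have h3 : (fun τ : ℝ => (Φ V (τ • L) (τ • Lt)
      - ∑ j ∈ Finset.range (p + 2), (τ ^ j / (j.factorial : ℝ)) • L ^ j
      - τ ^ (p + 1) • (c • L ^ (p + 1) + D V L Lt)) (x 0)) =O[𝓝[>] 0] fun τ => τ ^ (p + 2) := by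
    refine IsBigO.trans (IsBigO.of_bound ‖x 0‖ (Eventually.of_forall fun τ => ?_)) (h V L Lt)
    rw [mul_comm]
    exact ContinuousLinearMap.le_opNorm _ _
  refine eq_zero_of_pow_smul_isBigO (n := p + 1) (((h1.add h2).sub h3).congr_left fun τ => ?_)
  simp only [_root_.sub_apply, _root_.sum_apply, _root_.smul_apply]
  abel

/-! ### The complex plane as a test problem -/

/-- The complex plane, as a real inner product space in an arbitrary universe. -/
abbrev ComplexPlane : Type u := PiLp 2 fun _ : PUnit.{u + 1} => ℂ

/-- Multiplication by `z`. -/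
noncomputable def mulOperator (z : ℂ) : ComplexPlane.{u} →L[ℝ] ComplexPlane.{u} :=
  z • ContinuousLinearMap.id ℝ ComplexPlane.{u}

theorem mulOperator_apply (z : ℂ) (v : ComplexPlane.{u}) : mulOperator z v = z • v := rfl

theorem mulOperator_pow_apply (z : ℂ) (n : ℕ) (v : ComplexPlane.{u}) :
    (mulOperator z ^ n) v = z ^ n • v := by
  induction n with
  | zero => simp
  | succ n ih => rw [pow_succ', mul_apply_eq_comp, ih, mulOperator_apply, smul_smul, pow_succ']

theorem isAdjointOf_mulOperator (z : ℂ) :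
    IsAdjointOf (mulOperator.{u} (starRingEnd ℂ z)) (mulOperator z) := fun v w => by
  simp only [mulOperator_apply, PiLp.inner_apply, PiLp.smul_apply, Complex.inner, smul_eq_mul,
    map_mul]
  exact Finset.sum_congr rfl fun i _ => by ring_nf

theorem isSemiNegative_mulOperator {z : ℂ} (hz : z.re ≤ 0) :
    IsSemiNegative (mulOperator.{u} z) := fun v => by
  simp only [mulOperator_apply, PiLp.inner_apply, PiLp.smul_apply, Complex.inner, smul_eq_mul,
    map_mul]
  refine Finset.sum_nonpos fun i _ => ?_
  rw [mul_left_comm, Complex.mul_conj, Complex.re_mul_ofReal, Complex.conj_re]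
  exact mul_nonpos_of_nonpos_of_nonneg hz (Complex.normSq_nonneg _)

theorem isSolution_exp_smul (z : ℂ) (v : ComplexPlane.{u}) :
    IsSolution (mulOperator z) fun t : ℝ => Complex.exp (t * z) • v := fun t _ => by
  have h1 : HasDerivAt (fun t : ℝ => Complex.exp (t * z)) (Complex.exp (t * z) * z) t := by
    have := ((Complex.ofRealCLM.hasDerivAt (x := t)).mul_const z).cexp
    simpa using this
  have h2 := (h1.smul_const v).hasDerivWithinAt (s := Set.Ici 0)
  rwa [mulOperator_apply, smul_smul, mul_comm z]

/-- There is a point of the left half of the unit circle with `z^m = -1`, for even `m`. -/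
theorem exists_pow_eq_neg_one {m : ℕ} (hm : Even m) (hm0 : m ≠ 0) :
    ∃ z : ℂ, z.re ≤ 0 ∧ z * starRingEnd ℂ z = 1 ∧ z ^ m = -1 := by
  have hm2 : (2 : ℝ) ≤ m := by
    obtain ⟨r, rfl⟩ := hm
    exact_mod_cast (by omega : 2 ≤ r + r)
  -- The sign moves `e^{iπ/m}` to the left half plane, as `π/m ≤ π/2`, and disappears in the even
  -- power `m`.
  refine ⟨-Complex.exp ((Real.pi / m : ℝ) * Complex.I), ?_, ?_, ?_⟩
  · rw [Complex.neg_re, Complex.exp_ofReal_mul_I_re, neg_nonpos]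
    refine Real.cos_nonneg_of_mem_Icc ⟨?_, ?_⟩
    · have : 0 ≤ Real.pi / m := by positivity
      linarith [Real.pi_pos]
    · exact div_le_div_of_nonneg_left Real.pi_pos.le two_pos hm2
  · rw [Complex.mul_conj, Complex.normSq_neg, Complex.normSq_eq_norm_sq,
      Complex.norm_exp_ofReal_mul_I]
    simp
  · rw [hm.neg_pow, ← Complex.exp_nat_mul]
    have hmc : (m : ℂ) ≠ 0 := by exact_mod_cast hm0
    rw [show (m : ℂ) * ((Real.pi / m : ℝ) * Complex.I) = Real.pi * Complex.I by
      push_cast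
      field_simp]
    exact Complex.exp_pi_mul_I

/-- If on multiplication by a complex unit `z` the extra term acts like `d z^{p+1-m}` with an
even number `m > 0`, then it cannot compensate the truncation error. -/
theorem HasTruncationError.not_hasLinearOrderAtLeast {Φ D : LinearMethod.{u}} {p m : ℕ} {c d : ℝ}
    (h : HasTruncationError Φ D p c) (hc : c ≠ 0) (hm : Even m) (hm0 : m ≠ 0) (hmp : m ≤ p + 1)
    (hD : ∀ z : ℂ, z * starRingEnd ℂ z = 1 → ∀ v, D ComplexPlane (mulOperator z)
      (mulOperator (starRingEnd ℂ z)) v = ((d : ℂ) * z ^ (p + 1 - m)) • v) :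
    ¬ HasLinearOrderAtLeast Φ (p + 1) := by
  intro hΦ
  have key : ∀ z : ℂ, z.re ≤ 0 → z * starRingEnd ℂ z = 1 → (c : ℂ) * z ^ m + d = 0 := by
    intro z hz hz1
    have hz0 : z ≠ 0 := left_ne_zero_of_mul_eq_one hz1
    have h1 := h.apply_eq_zero hΦ (isSemiNegative_mulOperator hz) (isAdjointOf_mulOperator z)
      (isSolution_exp_smul z (WithLp.toLp 2 fun _ => (1 : ℂ)))
    simp only [Complex.ofReal_zero, zero_mul, Complex.exp_zero, one_smul, _root_.add_apply,
      _root_.smul_apply, mulOperator_pow_apply, hD z hz1] at h1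
    have h2 := congrArg (fun v : ComplexPlane.{u} => v PUnit.unit) h1
    simp only [PiLp.add_apply, PiLp.smul_apply, PiLp.zero_apply, smul_eq_mul, mul_one,
      Complex.real_smul] at h2
    have h3 : z ^ (p + 1) = z ^ (p + 1 - m) * z ^ m := by
      rw [← pow_add, Nat.sub_add_cancel hmp]
    refine (mul_eq_zero.1 (?_ : z ^ (p + 1 - m) * ((c : ℂ) * z ^ m + d) = 0)).resolve_left
      (pow_ne_zero _ hz0)
    rw [← h2, h3]
    ring
  -- This `z` gives `-c + d = 0` and the point `-1` gives `c + d = 0`, hence `c = 0`.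
  obtain ⟨z, hz, hz1, hzm⟩ := exists_pow_eq_neg_one hm hm0
  have h1 := key z hz hz1
  have h2 := key (-1) (by simp) (by simp)
  rw [hzm] at h1
  rw [hm.neg_one_pow] at h2
  have h3 : (c : ℂ) = 0 := by linear_combination (h2 - h1) / 2
  exact hc (by exact_mod_cast h3)

/-! ### The order of the two methods -/

theorem modifiedMethod_hasTruncationError {R : ℝ[X]} (hR : IsConsistent R) {p : ℕ} (hp1 : 1 ≤ p)
    (hp : ∀ k ≤ p, R.coeff k = 1 / (k.factorial : ℝ)) {μ ν : ℝ} {D : LinearMethod.{u}}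
    (hD : ∀ (V : Type u) [NormedAddCommGroup V] [InnerProductSpace ℝ V] (L Lt : V →L[ℝ] V),
      (fun τ : ℝ => superviscosity (leadingIndex R) μ ν (τ • L) (τ • Lt)
        - τ ^ (p + 1) • D V L Lt) =O[𝓝[>] 0] fun τ => τ ^ (p + 2)) :
    HasTruncationError (modifiedMethod R μ ν) D p
      (R.coeff (p + 1) - 1 / ((p + 1).factorial : ℝ)) := by
  intro V _ _ L Lt
  have hW : (fun τ : ℝ => superviscosity (leadingIndex R) μ ν (τ • L) (τ • Lt))
      =O[𝓝[>] 0] fun τ => τ ^ (p + 1) := by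
    have := ((hD V L Lt).trans (isBigO_pow_of_le (by omega : p + 1 ≤ p + 2))).add
      (isBigO_mul_pow_smul (le_refl (p + 1)) 1 (D V L Lt))
    simpa only [one_mul, sub_add_cancel] using this
  refine (((aeval_smul_sub_taylor_isBigO hp L).add (hD V L Lt)).add
    (aeval_add_sub_aeval_isBigO hR.2 hp1 L hW)).congr_left fun τ => ?_
  simp only [modifiedMethod, smul_add]
  abel

/-- `W R(Z)` differs from `W` by `W (R(Z) - 1)`, which is one order smaller. -/
theorem filteringMethod_hasTruncationError {R : ℝ[X]} (hR : IsConsistent R) {p : ℕ}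
    (hp : ∀ k ≤ p, R.coeff k = 1 / (k.factorial : ℝ)) {μ ν : ℝ} {D : LinearMethod.{u}}
    (hD : ∀ (V : Type u) [NormedAddCommGroup V] [InnerProductSpace ℝ V] (L Lt : V →L[ℝ] V),
      (fun τ : ℝ => superviscosity (leadingIndex R) μ ν (τ • L) (τ • Lt)
        - τ ^ (p + 1) • D V L Lt) =O[𝓝[>] 0] fun τ => τ ^ (p + 2)) :
    HasTruncationError (filteringMethod R μ ν) D p
      (R.coeff (p + 1) - 1 / ((p + 1).factorial : ℝ)) := by
  intro V _ _ L Lt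
  have hW : (fun τ : ℝ => superviscosity (leadingIndex R) μ ν (τ • L) (τ • Lt))
      =O[𝓝[>] 0] fun τ => τ ^ (p + 1) := by
    have := ((hD V L Lt).trans (isBigO_pow_of_le (by omega : p + 1 ≤ p + 2))).add
      (isBigO_mul_pow_smul (le_refl (p + 1)) 1 (D V L Lt))
    simpa only [one_mul, sub_add_cancel] using this
  have hWR := hW.mul (aeval_smul_sub_one_isBigO hR.1 L)
  simp only [← pow_add] at hWR
  refine (((aeval_smul_sub_taylor_isBigO hp L).add (hD V L Lt)).add hWR).congr_left fun τ => ?_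
  simp only [filteringMethod, smul_add, add_mul, mul_sub, one_mul, mul_one]
  abel

theorem superviscosity_smul {V : Type u} [NormedAddCommGroup V] [InnerProductSpace ℝ V]
    {k : ℕ} (hk : 1 ≤ k) (μ ν τ : ℝ) (L Lt : V →L[ℝ] V) :
    superviscosity k μ ν (τ • L) (τ • Lt) =
      (μ * τ ^ (2 * k - 1)) • (Lt ^ (k - 1) * L ^ k) + (ν * τ ^ (2 * k)) • (Lt ^ k * L ^ k) := by
  simp only [superviscosity, _root_.smul_pow, smul_mul_smul_comm, smul_smul, ← pow_add]
  rw [show k - 1 + k = 2 * k - 1 by omega, ← two_mul]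

/-- On the unit circle the conjugate is the inverse, so each adjoint factor cancels one factor `z`.
-/
theorem pow_mul_pow_mulOperator {z : ℂ} (hz : z * starRingEnd ℂ z = 1) (i j : ℕ)
    (v : ComplexPlane.{u}) :
    (mulOperator (starRingEnd ℂ z) ^ i * mulOperator z ^ (i + j)) v = z ^ j • v := by
  rw [mul_apply_eq_comp, mulOperator_pow_apply, mulOperator_pow_apply, smul_smul, pow_add,
    ← mul_assoc, ← mul_pow, mul_comm _ z, hz, one_pow, one_mul]

/-- Here `W` is exactly `τ^{p+1}` times `D`, and `D` acts on units as the scalar `ν`; hence `m = p +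
1`. -/
theorem hasLinearOrder_of_odd {R : ℝ[X]} (hR : IsConsistent R) {p : ℕ} (hp : HasRKOrder R p)
    (hk : 2 * leadingIndex R = p + 1) (ν : ℝ) :
    HasLinearOrder.{u} (modifiedMethod R 0 ν) p ∧
      HasLinearOrder.{u} (filteringMethod R 0 ν) p := by
  have hk1 := (leadingIndex_spec R hR.2).1
  let D : LinearMethod.{u} := fun V _ _ L Lt => ν • (Lt ^ leadingIndex R * L ^ leadingIndex R)
  have hD : ∀ (V : Type u) [NormedAddCommGroup V] [InnerProductSpace ℝ V] (L Lt : V →L[ℝ] V),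
      (fun τ : ℝ => superviscosity (leadingIndex R) 0 ν (τ • L) (τ • Lt)
        - τ ^ (p + 1) • D V L Lt) =O[𝓝[>] 0] fun τ => τ ^ (p + 2) := by
    intro V _ _ L Lt
    refine (isBigO_zero _ _).congr_left fun τ => ?_
    rw [superviscosity_smul hk1, hk]
    simp only [D]
    module
  have hDc : ∀ z : ℂ, z * starRingEnd ℂ z = 1 → ∀ v, D ComplexPlane (mulOperator z)
      (mulOperator (starRingEnd ℂ z)) v = ((ν : ℂ) * z ^ (p + 1 - (p + 1))) • v := by
    intro z hz v
    have := pow_mul_pow_mulOperator hz (leadingIndex R) 0 v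
    rw [add_zero] at this
    simp only [D, _root_.smul_apply, this, Nat.sub_self, pow_zero, one_smul, mul_one]
    rfl
  have heven : Even (p + 1) := ⟨leadingIndex R, by omega⟩
  have h1 := modifiedMethod_hasTruncationError hR (by omega) hp.1 hD
  have h2 := filteringMethod_hasTruncationError hR hp.1 hD
  exact ⟨⟨h1.hasLinearOrderAtLeast, h1.not_hasLinearOrderAtLeast (sub_ne_zero.2 hp.2) heven
      (by omega) le_rfl hDc⟩,
    ⟨h2.hasLinearOrderAtLeast, h2.not_hasLinearOrderAtLeast (sub_ne_zero.2 hp.2) heven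
      (by omega) le_rfl hDc⟩⟩

/-- The `ν`-term is of order `2k* = p + 2` and drops out. The `μ`-term has order `p + 1` and acts on
units as `μ z`; hence `m = p`. -/
theorem hasLinearOrder_of_even {R : ℝ[X]} (hR : IsConsistent R) {p : ℕ} (hp1 : 1 ≤ p)
    (hp : HasRKOrder R p) (hk : 2 * leadingIndex R = p + 2) (μ ν : ℝ) :
    HasLinearOrder.{u} (modifiedMethod R μ ν) p ∧
      HasLinearOrder.{u} (filteringMethod R μ ν) p := by
  have hk1 := (leadingIndex_spec R hR.2).1
  let D : LinearMethod.{u} := fun V _ _ L Lt =>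
    μ • (Lt ^ (leadingIndex R - 1) * L ^ leadingIndex R)
  have hD : ∀ (V : Type u) [NormedAddCommGroup V] [InnerProductSpace ℝ V] (L Lt : V →L[ℝ] V),
      (fun τ : ℝ => superviscosity (leadingIndex R) μ ν (τ • L) (τ • Lt)
        - τ ^ (p + 1) • D V L Lt) =O[𝓝[>] 0] fun τ => τ ^ (p + 2) := by
    intro V _ _ L Lt
    refine (isBigO_mul_pow_smul (le_refl (p + 2)) ν
      (Lt ^ leadingIndex R * L ^ leadingIndex R)).congr_left fun τ => ?_
    rw [superviscosity_smul hk1, hk, show p + 2 - 1 = p + 1 by omega]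
    simp only [D]
    module
  have hDc : ∀ z : ℂ, z * starRingEnd ℂ z = 1 → ∀ v, D ComplexPlane (mulOperator z)
      (mulOperator (starRingEnd ℂ z)) v = ((μ : ℂ) * z ^ (p + 1 - p)) • v := by
    intro z hz v
    have := pow_mul_pow_mulOperator hz (leadingIndex R - 1) 1 v
    rw [Nat.sub_add_cancel hk1] at this
    simp only [D, _root_.smul_apply, this, Nat.add_sub_cancel_left, mul_smul]
    rfl
  have heven : Even p := ⟨leadingIndex R - 1, by omega⟩
  have h1 := modifiedMethod_hasTruncationError hR hp1 hp.1 hD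
  have h2 := filteringMethod_hasTruncationError hR hp.1 hD
  exact ⟨⟨h1.hasLinearOrderAtLeast, h1.not_hasLinearOrderAtLeast (sub_ne_zero.2 hp.2) heven
      (by omega) (Nat.le_succ p) hDc⟩,
    ⟨h2.hasLinearOrderAtLeast, h2.not_hasLinearOrderAtLeast (sub_ne_zero.2 hp.2) heven
      (by omega) (Nat.le_succ p) hDc⟩⟩

theorem HasRKOrder.one_le {R : ℝ[X]} {p : ℕ} (hR : IsConsistent R) (hp : HasRKOrder R p) :
    1 ≤ p := by
  rcases Nat.eq_zero_or_pos p with rfl | h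
  · exact absurd (by simp [hR.2]) hp.2
  · exact h

theorem two_mul_eq_of_odd {k p : ℕ} (hk : k = ⌈((p : ℝ) + 1) / 2⌉₊) (hp : Odd p) :
    2 * k = p + 1 := by
  obtain ⟨r, rfl⟩ := hp
  rw [show ((2 * r + 1 : ℕ) + 1 : ℝ) / 2 = (r + 1 : ℕ) by push_cast; ring, Nat.ceil_natCast] at hk
  omega

theorem two_mul_eq_of_even {k p : ℕ} (hk : k = ⌈((p : ℝ) + 1) / 2⌉₊) (hp : Even p) :
    2 * k = p + 2 := by
  obtain ⟨r, rfl⟩ := hp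
  have : ⌈(((r + r : ℕ) : ℝ) + 1) / 2⌉₊ = r + 1 := by
    rw [Nat.ceil_eq_iff (by omega), Nat.add_sub_cancel]
    push_cast
    constructor <;> linarith
  omega

end Superviscosity

/-! ### The main theorem. -/

open Superviscosity
theorem mainTheorem1 (R : ℝ[X]) (p : ℕ) (hR : IsConsistent R) (hp : HasRKOrder R p)
    (hk : leadingIndex R = ⌈((p : ℝ) + 1) / 2⌉₊) :
    (Even p → ∃ μ₀ : ℝ, IsDispersiveBound R μ₀) ∧
    ∀ μ ν : ℝ, ν < -energyBeta R (leadingIndex R) / 2 →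
      ((Odd p ∧ μ = 0) ∨ (Even p ∧ ∃ μ₀ : ℝ, IsDispersiveBound R μ₀ ∧ μ₀ < μ)) →
        (IsStronglyStable.{u} (modifiedMethod R μ ν) ∧
          HasLinearOrder.{u} (modifiedMethod R μ ν) p) ∧
        (IsStronglyStable.{u} (filteringMethod R μ ν) ∧
          HasLinearOrder.{u} (filteringMethod R μ ν) p) := by
  refine ⟨fun he => exists_isDispersiveBound hp.1 (two_mul_eq_of_even hk he).le,
    fun μ ν hν h => ?_⟩
  have hp1 := hp.one_le hR
  rcases h with ⟨hodd, rfl⟩ | ⟨heven, μ₀, hμ₀, hμ⟩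
  · have hk2 := two_mul_eq_of_odd hk hodd
    have hpos := posDef_of_odd hp.1 hk2.le
    obtain ⟨h1, h2⟩ := hasLinearOrder_of_odd hR hp hk2 ν
    exact ⟨⟨modifiedMethod_isStronglyStable hR hν hpos (Or.inr rfl), h1⟩,
      filteringMethod_isStronglyStable hR hν hpos (Or.inr rfl), h2⟩
  · have hk2 := two_mul_eq_of_even hk heven
    have hpos := posDef_of_isDispersiveBound hp.1 hk2.le hμ₀ hμ
    obtain ⟨h1, h2⟩ := hasLinearOrder_of_even hR hp1 hp hk2 μ ν
    -- `p ≥ 1` and `2k* = p + 2` give `k* ≥ 2`, so the `μ`-term contains a power of `Zt`.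
    exact ⟨⟨modifiedMethod_isStronglyStable hR hν hpos (Or.inl (by omega)), h1⟩,
      filteringMethod_isStronglyStable hR hν hpos (Or.inl (by omega)), h2⟩
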